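/- **Setting.** Let $q\in\mathbb C$ with $0<|q|<1$. Put $\mathcal C=\mathbb Q[\hbar]$, $\mathfrak H=\mathcal C\langle a,b\rangle$ (non-commutative polynomials), $g_k=ba^k$ and $e_k=b(a+\hbar)a^{k-1}$ for $k\ge 1$, so that $e_1-g_1=\hbar b$. Let $\mathcal C\langle A\rangle$ be the $\mathcal C$-subalgebra of $\mathfrak H$ generated by $A=\{\hbar b\}\cup\{g_k\mid k\ge1\}$; it is freely generated by $A$. Let $\hbar$ act on $\mathbb C$ as multiplication by $1-q$, put $[m]=\frac{1-q^m}{1-q}$, and for $m\ge 1$ set $$F_q(m;\hbar b)=1-q,\qquad F_q(m;g_k)=\frac{q^{km}}{[m]^k}\quad(k\ge 1).$$ Let $Z_{q,M}:\mathcal C\langle A\rangle\to\mathbb C$ be the $\mathcal C$-linear map with $$Z_{q,M}(u_1\cdots u_r)=\sum_{0<m_1<\cdots<m_r<M}\ \prod_{i=1}^rF_q(m_i;u_i)\qquad(u_1,\dots,u_r\in A),\qquad Z_{q,M}(1)=1 .$$ Put $\widehat{\mathfrak H^0}=\mathcal C+\sum_{k\ge1}\mathcal C\langle A\rangle g_k$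 and $Z_q(w)=\lim_{M\to\infty}Z_{q,M}(w)$ for $w\in\widehat{\mathfrak H^0}$; write $\widehat{\mathcal Z_q}=Z_q(\widehat{\mathfrak H^0})$. Let $\mathfrak n_0$ be the $\mathcal C$-span of the monomials $(e_1-g_1)^{\alpha_1}g_{\beta_1+1}\cdots(e_1-g_1)^{\alpha_r}g_{\beta_r+1}$ with $r\ge1$, $\alpha_i,\beta_i\ge0$, and $\alpha_s,\beta_t\ge1$ for some $1\le s\le t\le r$. Put $\mathfrak n=\mathfrak n_0+\hbar\,\widehat{\mathfrak H^0}$ and $\mathcal N_q=Z_q(\mathfrak n)$. The shuffle product $\mathrm{sh}_\hbar$ is the $\mathcal C$-bilinear operation on $\mathfrak H$ determined by $w\,\mathrm{sh}_\hbar\,1=1\,\mathrm{sh}_\hbar\,w=w$ and $$wa\,\mathrm{sh}_\hbar\,w'a=(wa\,\mathrm{sh}_\hbar\,w'+w\,\mathrm{sh}_\hbar\,w'a+\hbar\,w\,\mathrm{sh}_\hbar\,w')a,\qquad wb\,\mathrm{sh}_\hbar\,w'=w\,\mathrm{sh}_\hbar\,w'b=(w\,\mathrm{sh}_\hbar\,w')b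 .$$ Powers $u^{\mathrm{sh}_\hbar j}$ are taken for this product, which extends coefficientwise to $\mathfrak H[[X]]$; for $f\in\mathfrak H[[X]]$ with $f(0)=0$, $\exp_{\mathrm{sh}_\hbar}(f)=\sum_{n\ge0}\frac1{n!}f^{\mathrm{sh}_\hbar n}$. Juxtaposition is concatenation, and $\frac1{1-g_1X}=\sum_{n\ge0}g_1^nX^n$. The map $Z_q$ is applied to power series coefficientwise. An index is a finite, possibly empty, tuple $\mathbf k=(k_1,\dots,k_r)$ of positive integers; it is admissible if it is empty or $k_r\ge2$. Put $g_{\mathbf k}=g_{k_1}\cdots g_{k_r}$ (with $g_\varnothing=1$), $$E_{1^m}=\frac1{(m+1)!}\sum_{j=0}^m g_1^{\mathrm{sh}_\hbar j}\,\mathrm{sh}_\hbar\,e_1^{\mathrm{sh}_\hbar(m-j)},$$ and $E_{\mathbf k}=E_{1^{s_0}}e_{t_1+2}E_{1^{s_1}}\cdots e_{t_r+2}E_{1^{s_r}}$ for $\mathbf k=(\{1\}^{s_0},t_1+2,\{1\}^{s_1},\dots,t_r+2,\{1\}^{s_r})$ with $r,s_i,t_i\ge0$, where $\{1\}^s$ denotes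 $s$ entries equal to $1$ (in particular $E_\varnothing=1$). **Theorem.** For every $w\in\widehat{\mathfrak H^0}$ the limit $Z_q(w)$ exists. For every admissible index $\mathbf k$, all coefficients of $g_{\mathbf k}\frac1{1-g_1X}$ and of $E_{\mathbf k}\exp_{\mathrm{sh}_\hbar}(g_1X)$ lie in $\widehat{\mathfrak H^0}$, and $$Z_q\Big(g_{\mathbf k}\,\frac{1}{1-g_1X}\Big)\equiv\exp\Big(\sum_{n\ge2}\frac{(-1)^{n-1}}{n}Z_q(g_n)X^n\Big)\,Z_q\big(E_{\mathbf k}\exp_{\mathrm{sh}_\hbar}(g_1X)\big)$$ in $\widehat{\mathcal Z_q}[[X]]$ modulo $\mathcal N_q[[X]]$; that is, all coefficients of both sides lie in $\widehat{\mathcal Z_q}$ and every coefficient of their difference lies in $\mathcal N_q$. -/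

import Mathlib

noncomputable section

namespace QMZV

open Filter Topology
open scoped Pointwise

/-- The two letters `a`, `b`. -/
inductive AB
  | a
  | b

/-- The coefficient ring `𝒞 = ℚ[ħ]`. -/
abbrev Coef := Polynomial ℚ

/-- The non-commutative polynomial ring `ℌ = 𝒞⟨a, b⟩`. -/
abbrev H := FreeAlgebra Coef AB

/-- The element `a` of `ℌ`. -/
def a : H := FreeAlgebra.ι Coef AB.a

/-- The element `b` of `ℌ`. -/
def b : H := FreeAlgebra.ι Coef AB.b

/-- The central element `ħ` of `ℌ`. -/
def hbar : H := algebraMap Coef H Polynomial.X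

/-- `g_k = b a^k` (used for `k ≥ 1`). -/
def g (k : ℕ) : H := b * a ^ k

/-- `e_k = b (a + ħ) a^(k-1)` (used for `k ≥ 1`). -/
def e (k : ℕ) : H := b * (a + hbar) * a ^ (k - 1)

/-! ### The subalgebra generated by `A` -/

/-- Names of the elements of `A = {ħ b} ∪ {g_k | k ≥ 1}`:
`d` stands for `ħ b = e_1 - g_1` and `g k` for `g_k`. -/
inductive Letter
  | d
  | g (k : ℕ+)

/-- The element of `ℌ` named by a letter. -/
def Letter.val : Letter → H
  | .d => hbar * b
  | .g k => QMZV.g k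

/-- The set `A`. -/
def setA : Set H := {hbar * b} ∪ {w | ∃ k : ℕ, 1 ≤ k ∧ w = g k}

/-- `𝒞⟨A⟩`, the `𝒞`-subalgebra of `ℌ` generated by `A`. -/
def CA : Subalgebra Coef H := Algebra.adjoin Coef setA

/-- The canonical map from the free algebra on the letters onto `𝒞⟨A⟩`. -/
def toH : FreeAlgebra Coef Letter →ₐ[Coef] H := FreeAlgebra.lift Coef Letter.val

theorem e_one_sub_g_one : e 1 - g 1 = hbar * b := by
  have h : b * hbar = hbar * b := (Algebra.commutes (Polynomial.X : Coef) b).symm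
  simp [e, g, mul_add, h]

theorem range_val : Set.range Letter.val = setA := by
  ext w
  constructor
  · rintro ⟨u, rfl⟩
    cases u with
    | d => exact Or.inl rfl
    | g k => exact Or.inr ⟨k, k.2, rfl⟩
  · rintro (h | ⟨k, hk, rfl⟩)
    · exact ⟨.d, h.symm⟩
    · exact ⟨.g ⟨k, hk⟩, rfl⟩

theorem range_toH : toH.range = CA := by
  rw [CA, ← range_val, Algebra.adjoin_range_eq_range_freeAlgebra_lift, toH]

theorem basis_eq {X : Type} (u : FreeMonoid X) :
    FreeAlgebra.basisFreeMonoid Coef X u = FreeMonoid.lift (FreeAlgebra.ι Coef) u := by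
  simp [FreeAlgebra.basisFreeMonoid, FreeAlgebra.equivMonoidAlgebraFreeMonoid]

/-- The exponent of `a` in a letter, `ħ b` counting as `0`. -/
def Letter.exponent : Letter → ℕ
  | .d => 0
  | .g k => k

/-- The word in `a`, `b` underlying a letter. -/
def Letter.word (u : Letter) : List AB := AB.b :: List.replicate u.exponent AB.a

/-- The word in `a`, `b` underlying a word in the letters. -/
def flat (u : List Letter) : List AB := (u.map Letter.word).flatten

/-- The coefficient with which the underlying word occurs. -/
def Letter.coef : Letter → Coef
  | .d => Polynomial.X
  | .g _ => 1

theorem Letter.exponent_injective : Function.Injective Letter.exponent := by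
  intro u v h
  cases u with
  | d => cases v with
    | d => rfl
    | g l => exact absurd h.symm l.ne_zero
  | g k => cases v with
    | d => exact absurd h k.ne_zero
    | g l => exact congrArg Letter.g (PNat.eq h)

theorem flat_cons (x : Letter) (u : List Letter) :
    flat (x :: u) = AB.b :: (List.replicate x.exponent AB.a ++ flat u) := by
  simp [flat, Letter.word]

theorem replicate_append_flat {m n : ℕ} {u v : List Letter}
    (h : List.replicate m AB.a ++ flat u = List.replicate n AB.a ++ flat v) :
    m = n ∧ flat u = flat v := by
  induction m generalizing n with
  | zero =>
    cases n with
    | zero => exact ⟨rfl, by simpa using h⟩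
    | succ n =>
      cases u with
      | nil => simp [flat, List.replicate_succ] at h
      | cons x u => simp [flat_cons, List.replicate_succ] at h
  | succ m ih =>
    cases n with
    | zero =>
      cases v with
      | nil => simp [flat, List.replicate_succ] at h
      | cons x u => simp [flat_cons, List.replicate_succ] at h
    | succ n =>
      simp only [List.replicate_succ, List.cons_append, List.cons.injEq, true_and] at h
      obtain ⟨h1, h2⟩ := ih h
      exact ⟨by rw [h1], h2⟩

theorem flat_injective : Function.Injective flat := by
  intro u
  induction u with
  | nil =>
    intro v h
    cases v with
    | nil => rfl
    | cons y v => simp [flat] at h; simp [Letter.word] at h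
  | cons x u ih =>
    intro v h
    cases v with
    | nil => simp [flat] at h; simp [Letter.word] at h
    | cons y v =>
      rw [flat_cons, flat_cons, List.cons.injEq] at h
      obtain ⟨h1, h2⟩ := replicate_append_flat h.2
      rw [Letter.exponent_injective h1, ih h2]

theorem Letter.val_eq (u : Letter) :
    u.val = u.coef • (u.word.map (FreeAlgebra.ι Coef)).prod := by
  cases u with
  | d => simp [Letter.val, Letter.coef, Letter.word, Letter.exponent, hbar, b, Algebra.smul_def]
  | g k => simp [Letter.val, Letter.coef, Letter.word, Letter.exponent, QMZV.g, a, b]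

theorem toH_basis (u : List Letter) :
    toH (FreeAlgebra.basisFreeMonoid Coef Letter (FreeMonoid.ofList u)) =
      (u.map Letter.coef).prod •
        FreeAlgebra.basisFreeMonoid Coef AB (FreeMonoid.ofList (flat u)) := by
  simp only [basis_eq, FreeMonoid.lift_ofList]
  induction u with
  | nil => simp [flat]
  | cons x u ih =>
    simp only [List.map_cons, List.prod_cons, map_mul, ih]
    rw [toH, FreeAlgebra.lift_ι_apply, x.val_eq]
    simp [flat, smul_smul, mul_comm]

/-- `A` is algebraically independent: `𝒞⟨A⟩` is free on `A`. -/
theorem toH_injective : Function.Injective toH := by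
  have key : ∀ (u : List Letter) (x : FreeAlgebra Coef Letter),
      (FreeAlgebra.basisFreeMonoid Coef AB).repr (toH x) (FreeMonoid.ofList (flat u)) =
        (u.map Letter.coef).prod *
          (FreeAlgebra.basisFreeMonoid Coef Letter).repr x (FreeMonoid.ofList u) := by
    intro u x
    have hx : x ∈ Submodule.span Coef (Set.range (FreeAlgebra.basisFreeMonoid Coef Letter)) := by
      rw [Module.Basis.span_eq]; trivial
    induction hx using Submodule.span_induction with
    | zero => simp
    | add x y _ _ hx hy => simp [hx, hy, mul_add]
    | smul c x _ hx => simp [hx]; ring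
    | mem x hx =>
      obtain ⟨v, rfl⟩ := hx
      obtain ⟨v, rfl⟩ := FreeMonoid.ofList.surjective v
      rw [toH_basis]
      by_cases h : v = u
      · subst h; simp
      · have h' : flat v ≠ flat u := fun h' => h (flat_injective h')
        simp [h, h']
  rw [injective_iff_map_eq_zero]
  intro x hx
  apply (FreeAlgebra.basisFreeMonoid Coef Letter).repr.map_eq_zero_iff.mp
  ext1 u
  obtain ⟨u, rfl⟩ := FreeMonoid.ofList.surjective u
  have h := key u x
  rw [hx] at h
  have hne : (u.map Letter.coef).prod ≠ 0 := by
    intro h0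
    rw [List.prod_eq_zero_iff] at h0
    obtain ⟨y, -, hy⟩ := List.mem_map.mp h0
    cases y <;> simp [Letter.coef] at hy
  simpa [hne] using h.symm

/-! ### The maps `Z_{q,M}` and `Z_q` -/

/-- The `q`-integer `[m]`. -/
def qInt (q : ℂ) (m : ℕ) : ℂ := (1 - q ^ m) / (1 - q)

/-- The values `F_q(m; u)`, `u ∈ A`. -/
def F (q : ℂ) (m : ℕ) : Letter → ℂ
  | .d => 1 - q
  | .g k => q ^ ((k : ℕ) * m) / qInt q m ^ (k : ℕ)

open Classical in
/-- `∑_{0 < m_1 < ⋯ < m_r < M} ∏_i F_q(m_i; u_i)` for a word `u_1 ⋯ u_r`. -/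
def wordSum (q : ℂ) (M : ℕ) (u : List Letter) : ℂ :=
  ∑ m ∈ (Fintype.piFinset fun _ : Fin u.length => Finset.Ioo 0 M).filter
      (fun m => StrictMono m),
    ∏ i, F q (m i) (u.get i)

/-- `ħ` acts on `ℂ` as `1 - q`. -/
def evalCoef (q : ℂ) : Coef →+* ℂ := (Polynomial.aeval (1 - q) : Coef →ₐ[ℚ] ℂ).toRingHom

/-- `Z_{q,M}` on the free algebra on the letters: the `𝒞`-linear extension of `wordSum`. -/
def freeZ (q : ℂ) (M : ℕ) (x : FreeAlgebra Coef Letter) : ℂ :=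
  ((FreeAlgebra.basisFreeMonoid Coef Letter).repr x).sum
    fun u c => evalCoef q c * wordSum q M (FreeMonoid.toList u)

/-- `Z_{q,M}` on `𝒞⟨A⟩`, transported along the isomorphism `toH` of the free algebra with
`𝒞⟨A⟩`; it is set to `0` outside `𝒞⟨A⟩`, where it is never used. -/
def ZM (q : ℂ) (M : ℕ) : H → ℂ := Function.extend toH (freeZ q M) 0

/-- `Z_q(w) = lim_{M → ∞} Z_{q,M}(w)`. -/
def Z (q : ℂ) (w : H) : ℂ := limUnder atTop (fun M : ℕ => ZM q M w)

theorem ZM_word (q : ℂ) (M : ℕ) (u : List Letter) :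
    ZM q M (u.map Letter.val).prod = wordSum q M u := by
  have h : (u.map Letter.val).prod =
      toH (FreeAlgebra.basisFreeMonoid Coef Letter (FreeMonoid.ofList u)) := by
    rw [basis_eq, FreeMonoid.lift_ofList, map_list_prod, List.map_map]
    congr 2
    ext1 x
    simp [toH]
  rw [h, ZM, toH_injective.extend_apply, freeZ]
  simp

/-! ### The submodules `Ĥ⁰`, `𝔫` and their images -/

/-- `Ĥ⁰ = 𝒞 + ∑_{k ≥ 1} 𝒞⟨A⟩ g_k`. -/
def HHat : Submodule Coef H :=
  1 ⊔ ⨆ k : ℕ+, (Subalgebra.toSubmodule CA).map (LinearMap.mulRight Coef (g k))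

/-- The monomial `(e_1-g_1)^{α_1} g_{β_1+1} ⋯ (e_1-g_1)^{α_r} g_{β_r+1}`,
the list being `(α_1, β_1), …, (α_r, β_r)`. -/
def monomial (l : List (ℕ × ℕ)) : H :=
  (l.map fun p => (e 1 - g 1) ^ p.1 * g (p.2 + 1)).prod

/-- `𝔫₀`: the span of the monomials with `α_s ≥ 1`, `β_t ≥ 1` for some `s ≤ t`. -/
def n0 : Submodule Coef H :=
  Submodule.span Coef {w | ∃ l : List (ℕ × ℕ),
    (∃ s t : Fin l.length, s ≤ t ∧ 1 ≤ (l.get s).1 ∧ 1 ≤ (l.get t).2) ∧ w = monomial l}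

/-- `𝔫 = 𝔫₀ + ħ Ĥ⁰`. -/
def nn : Submodule Coef H := n0 ⊔ (Polynomial.X : Coef) • HHat

/-- `Ẑ_q`, the image of `Ĥ⁰` under `Z_q`. -/
def ZHat (q : ℂ) : Set ℂ := Z q '' (HHat : Set H)

/-- `𝒩_q = Z_q(𝔫)`. -/
def NN (q : ℂ) : Set ℂ := Z q '' (nn : Set H)

/-! ### The shuffle product on `ℌ` -/

/-- The word with letters `l`, the head of `l` being the LAST letter of the word. -/
def revWord (l : List AB) : H := (l.reverse.map (FreeAlgebra.ι Coef)).prod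

/-- The shuffle product of two words, given by their reversed lists of letters. -/
def shWord : List AB → List AB → H
  | [], v => revWord v
  | u, [] => revWord u
  | AB.b :: u, v => shWord u v * b
  | u, AB.b :: v => shWord u v * b
  | AB.a :: u, AB.a :: v =>
      (shWord (AB.a :: u) v + shWord u (AB.a :: v) + hbar * shWord u v) * a
termination_by u v => u.length + v.length

/-- The shuffle product on `ℌ`. -/
def sh : H →ₗ[Coef] H →ₗ[Coef] H :=
  (FreeAlgebra.basisFreeMonoid Coef AB).constr Coef fun u =>
    (FreeAlgebra.basisFreeMonoid Coef AB).constr Coef fun v =>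
      shWord (FreeMonoid.toList u).reverse (FreeMonoid.toList v).reverse

theorem sh_basis (u v : List AB) : sh (revWord u) (revWord v) = shWord u v := by
  have h : ∀ l : List AB, revWord l =
      FreeAlgebra.basisFreeMonoid Coef AB (FreeMonoid.ofList l.reverse) := by
    intro l
    rw [basis_eq, FreeMonoid.lift_ofList, revWord]
  rw [h, h, sh, Module.Basis.constr_basis, Module.Basis.constr_basis]
  simp

theorem revWord_cons (x : AB) (u : List AB) :
    revWord (x :: u) = revWord u * FreeAlgebra.ι Coef x := by
  simp [revWord]

theorem span_revWord : Submodule.span Coef (Set.range revWord) = ⊤ := by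
  rw [← (FreeAlgebra.basisFreeMonoid Coef AB).span_eq]
  congr 1
  ext w
  constructor
  · rintro ⟨l, rfl⟩
    exact ⟨FreeMonoid.ofList l.reverse, by rw [basis_eq, FreeMonoid.lift_ofList, revWord]⟩
  · rintro ⟨u, rfl⟩
    exact ⟨(FreeMonoid.toList u).reverse, by
      rw [basis_eq, revWord, List.reverse_reverse, FreeMonoid.lift_apply]⟩

theorem lin_ext {f f' : H →ₗ[Coef] H} (h : ∀ u, f (revWord u) = f' (revWord u)) : f = f' :=
  LinearMap.ext_on_range (v := revWord) span_revWord h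

theorem one_sh (w : H) : sh 1 w = w := by
  have : sh 1 = LinearMap.id := lin_ext fun u => by
    have h1 : (1 : H) = revWord [] := by simp [revWord]
    rw [h1, sh_basis, shWord]; rfl
  rw [this]; rfl

theorem sh_one (w : H) : sh w 1 = w := by
  have : sh.flip 1 = LinearMap.id := lin_ext fun u => by
    have h1 : (1 : H) = revWord [] := by simp [revWord]
    rw [h1, LinearMap.flip_apply, sh_basis]
    cases u <;> simp [shWord]
  exact LinearMap.congr_fun this w

theorem shWord_b_left (u v : List AB) : shWord (AB.b :: u) v = shWord u v * b := by
  cases v with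
  | nil => cases u <;> simp [shWord, revWord_cons, b]
  | cons y v => rw [shWord]; simp

theorem shWord_b_right (u v : List AB) : shWord u (AB.b :: v) = shWord u v * b := by
  induction u with
  | nil => simp [shWord, revWord_cons, b]
  | cons x u ih =>
    cases x with
    | a => rw [shWord] <;> simp
    | b => rw [shWord_b_left, ih, shWord_b_left]

theorem mul_b_sh (w w' : H) : sh (w * b) w' = sh w w' * b := by
  have : sh.comp (LinearMap.mulRight Coef b) = sh.compr₂ (LinearMap.mulRight Coef b) := by
    refine LinearMap.ext_on_range (v := revWord) span_revWord fun u => lin_ext fun v => ?_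
    have := sh_basis (AB.b :: u) v
    rw [revWord_cons, shWord_b_left, ← sh_basis] at this
    exact this
  exact LinearMap.congr_fun (LinearMap.congr_fun this w) w'

theorem sh_mul_b (w w' : H) : sh w (w' * b) = sh w w' * b := by
  have : sh.compl₂ (LinearMap.mulRight Coef b) = sh.compr₂ (LinearMap.mulRight Coef b) := by
    refine LinearMap.ext_on_range (v := revWord) span_revWord fun u => lin_ext fun v => ?_
    have := sh_basis u (AB.b :: v)
    rw [revWord_cons, shWord_b_right, ← sh_basis] at this
    exact this
  exact LinearMap.congr_fun (LinearMap.congr_fun this w) w'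

theorem mul_a_sh_mul_a (w w' : H) :
    sh (w * a) (w' * a) = (sh (w * a) w' + sh w (w' * a) + hbar * sh w w') * a := by
  have : (sh.compl₂ (LinearMap.mulRight Coef a)).comp (LinearMap.mulRight Coef a) =
      (sh.comp (LinearMap.mulRight Coef a) + sh.compl₂ (LinearMap.mulRight Coef a) +
        sh.compr₂ (LinearMap.mulLeft Coef hbar)).compr₂ (LinearMap.mulRight Coef a) := by
    refine LinearMap.ext_on_range (v := revWord) span_revWord fun u => lin_ext fun v => ?_
    have := sh_basis (AB.a :: u) (AB.a :: v)
    rw [shWord, ← sh_basis, ← sh_basis, ← sh_basis, revWord_cons, revWord_cons] at this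
    exact this
  exact LinearMap.congr_fun (LinearMap.congr_fun this w) w'

/-- The shuffle power `u^{sh j}`. -/
def shPow (u : H) : ℕ → H
  | 0 => 1
  | j + 1 => sh u (shPow u j)

/-! ### The elements `g_𝐤` and `E_𝐤` -/

/-- An index: a finite tuple of positive integers. -/
abbrev Index := List ℕ+

/-- An index is admissible if it is empty or its last entry is at least `2`. -/
def Admissible (k : Index) : Prop := ∀ h : k ≠ [], 2 ≤ k.getLast h

/-- `g_𝐤 = g_{k_1} ⋯ g_{k_r}`. -/
def gIndex (k : Index) : H := (k.map fun j : ℕ+ => g j).prod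

/-- `E_{1^m}`. -/
def E1 (m : ℕ) : H :=
  (1 / ((m + 1).factorial : ℚ)) •
    ∑ j ∈ Finset.range (m + 1), sh (shPow (g 1) j) (shPow (e 1) (m - j))

/-- `E_𝐤` for `𝐤` preceded by `s` further ones. -/
def EAux : ℕ → Index → H
  | s, [] => E1 s
  | s, k :: l => if k = 1 then EAux (s + 1) l else E1 s * e k * EAux 0 l

/-- `E_𝐤 = E_{1^{s_0}} e_{t_1+2} E_{1^{s_1}} ⋯ e_{t_r+2} E_{1^{s_r}}` for the index
`𝐤 = (1^{s_0}, t_1+2, 1^{s_1}, …, t_r+2, 1^{s_r})`, where `1^s` stands for `s` ones. -/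
def EIndex (k : Index) : H := EAux 0 k

theorem EAux_replicate (s m : ℕ) (l : Index) :
    EAux s (List.replicate m 1 ++ l) = EAux (s + m) l := by
  induction m generalizing s with
  | zero => simp
  | succ m ih => simp [List.replicate_succ, EAux, ih, Nat.add_assoc, Nat.add_comm 1 m]

theorem EIndex_replicate (s : ℕ) : EIndex (List.replicate s 1) = E1 s := by
  simpa [EIndex, EAux] using EAux_replicate 0 s []

theorem EIndex_replicate_append (s t : ℕ) (l : Index) :
    EIndex (List.replicate s 1 ++ ⟨t + 2, Nat.succ_pos _⟩ :: l) =
      E1 s * e (t + 2) * EIndex l := by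
  rw [EIndex, EAux_replicate, Nat.zero_add]
  rfl

/-! ### Power series -/

/-- `1 / (1 - w X) = ∑ w^n X^n` in `ℌ[[X]]`. -/
def geom (w : H) : PowerSeries H := PowerSeries.mk fun n => w ^ n

theorem one_sub_mul_geom (w : H) :
    (1 - PowerSeries.C w * PowerSeries.X) * geom w = 1 := by
  ext n
  cases n with
  | zero => simp [geom, sub_mul, mul_assoc]
  | succ n => simp [geom, sub_mul, mul_assoc, PowerSeries.coeff_succ_X_mul, pow_succ',
      PowerSeries.coeff_one]

/-- The shuffle product of power series, `X` being central. -/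
def shSeries (f f' : PowerSeries H) : PowerSeries H :=
  PowerSeries.mk fun n => ∑ p ∈ Finset.HasAntidiagonal.antidiagonal n,
    sh (PowerSeries.coeff p.1 f) (PowerSeries.coeff p.2 f')

/-- The shuffle power of a power series. -/
def shSeriesPow (f : PowerSeries H) : ℕ → PowerSeries H
  | 0 => 1
  | j + 1 => shSeries f (shSeriesPow f j)

/-- `exp_sh(f(X)) = 1 + ∑_{j ≥ 1} f^{sh j} / j!` for `f(0) = 0`; for such `f` the terms with
`j > n` do not contribute to the coefficient of `X^n`. -/
def expSh (f : PowerSeries H) : PowerSeries H :=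
  PowerSeries.mk fun n => ∑ j ∈ Finset.range (n + 1),
    (1 / (j.factorial : ℚ)) • PowerSeries.coeff n (shSeriesPow f j)

/-- `Z_q` applied coefficientwise. -/
def ZSeries (q : ℂ) (f : PowerSeries H) : PowerSeries ℂ :=
  PowerSeries.mk fun n => Z q (PowerSeries.coeff n f)

/-- `∑_{n ≥ 2} ((-1)^(n-1) / n) Z_q(g_n) X^n`. -/
def logSeries (q : ℂ) : PowerSeries ℂ :=
  PowerSeries.mk fun n => if 2 ≤ n then (-1) ^ (n - 1) / (n : ℂ) * Z q (g n) else 0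

end QMZV

end

noncomputable section

namespace QMZV

open Filter Topology
open scoped Pointwise
open Finset.HasAntidiagonal (antidiagonal)

/-! ### Sequences of truncated sums -/

/-! The argument compares sequences of truncated sums. Pointwise multiplication of such sequences is
the harmonic product of words: it makes `SH` (the sequences of elements of Ĥ⁰) a ring and `SN`
(those of 𝔫) an ideal of it (`mul_mem_SH`, `mul_mem_SN`), and limits carry both properties over to
Ẑ_q and 𝒩_q.

Let P and D be the series of truncated sums of 1/(1-g_1X) and exp_sh(g_1X) (`pseq`, `dseq`). P is
the finite product ∏(1+F_q(m;g_1)X), so Newton's identities give the limit exp(∑_{n≥1} (-1)^(n-1)/n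
Z_q(g_n) X^n) (`pseq_tendsTo`). A q-difference equation for L(t) = ∑ q^m/[m] t^m shows that D tends
to exp(Z_q(g_1)X) (`dseq_eq_cum`, `dseq_tendsTo`). The quotient E of the two limits is the
exponential factor of the theorem. This is the case of the empty index, where the congruence is an
equality.

For a nonempty admissible 𝐤, let x_m be the part of the truncated sum of g_𝐤 whose last, and
largest, summation index is m. Then g_𝐤/(1-g_1X) gives ∑_m x_m ∏_{m<j<M}(1+F_q(j;g_1)X). Put B = ∑_m
x_m ∏_{j≤m}(1+F_q(j;g_1)X)⁻¹. Then B·P is exactly the series of g_𝐤/(1-g_1X)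
(`sum_psum_xseq_mul_pseq`), and B·D is that of g_𝐤 exp_sh(g_1X) modulo `SN`
(`sum_psum_xseq_mul_dseq_sub_mem`). The second fact holds because the last letter of g_𝐤 is some g_k
with k ≥ 2: a word in which ħb precedes this letter is negligible, and a collision with ħb produces
a factor ħ. For the same reason E_𝐤 ≡ g_𝐤 modulo 𝔫 (`exists_EIndex`).

In the limit, with β = lim B and D now its limit, the left side is β·E·D and Z_q(E_𝐤 exp_sh(g_1X)) ≡
β·D. As E has coefficients in Ẑ_q and 𝒩_q is an ideal there, multiplication by E proves the theorem
(`coeff_sub_mem_NN`). -/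

/-- Complex sequences, `ħ` acting as `1 - q`. The entry with index `N` of the sequence of a word
is its truncated sum over `m_r < N + 1`. -/
def Seq (_q : ℂ) : Type := ℕ → ℂ

instance (q : ℂ) : CommRing (Seq q) := inferInstanceAs (CommRing (ℕ → ℂ))

instance (q : ℂ) : Algebra Coef (Seq q) :=
  RingHom.toAlgebra ((Pi.constRingHom ℕ ℂ).comp (evalCoef q))

variable {q : ℂ}

@[ext] theorem Seq.ext {f f' : Seq q} (h : ∀ N, f N = f' N) : f = f' := funext h

theorem Seq.add_apply (f f' : Seq q) (N : ℕ) : (f + f') N = f N + f' N := rfl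
theorem Seq.mul_apply (f f' : Seq q) (N : ℕ) : (f * f') N = f N * f' N := rfl
theorem Seq.one_apply (N : ℕ) : (1 : Seq q) N = 1 := rfl

theorem Seq.smul_apply (c : Coef) (f : Seq q) (N : ℕ) : (c • f) N = evalCoef q c * f N := by
  rw [Algebra.smul_def]; rfl

theorem evalCoef_X : evalCoef q Polynomial.X = 1 - q := by
  simp [evalCoef]

theorem evalCoef_C (r : ℚ) : evalCoef q (Polynomial.C r) = r := by
  simp [evalCoef]

/-- Evaluation at an index. -/
def Seq.eval (N : ℕ) : Seq q →+* ℂ := Pi.evalRingHom (fun _ : ℕ => ℂ) N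

theorem Seq.sum_apply {ι : Type*} (s : Finset ι) (f : ι → Seq q) (N : ℕ) :
    (∑ i ∈ s, f i) N = ∑ i ∈ s, f i N := map_sum (Seq.eval N) f s

/-- Partial sums. -/
def psum : Seq q →ₗ[Coef] Seq q where
  toFun f := fun N => ∑ n ∈ Finset.range N, f n
  map_add' f f' := by
    ext N; exact Finset.sum_add_distrib
  map_smul' c f := by
    ext N
    exact (Finset.sum_congr rfl fun n _ => Seq.smul_apply c f n).trans
      ((Finset.mul_sum _ _ _).symm.trans (Seq.smul_apply c (fun M => ∑ n ∈ Finset.range M, f n : Seq q) N).symm)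

theorem psum_apply (f : Seq q) (N : ℕ) : psum f N = ∑ n ∈ Finset.range N, f n := rfl

theorem psum_zero (f : Seq q) : psum f 0 = 0 := rfl

theorem psum_succ (f : Seq q) (N : ℕ) : psum f (N + 1) = psum f N + f N :=
  Finset.sum_range_succ _ _

/-- Pairs of summation indices lie below, above or on the diagonal. This is the source of the
harmonic product. -/
theorem psum_mul_psum (f f' : Seq q) :
    psum f * psum f' = psum (f * psum f') + psum (psum f * f') + psum (f * f') := by
  ext N
  simp only [Seq.add_apply, Seq.mul_apply]
  induction N with
  | zero => simp [psum_zero]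
  | succ N ih =>
    simp only [psum_succ, Seq.mul_apply]
    linear_combination ih

/-- The sequence of values `F_q(m; u)`. -/
def Fseq (q : ℂ) (u : Letter) : Seq q := fun N => F q (N + 1) u

/-- Appending a letter to a word, on the level of truncated sums. -/
def step (u : Letter) : Seq q →ₗ[Coef] Seq q := psum.comp (LinearMap.mulLeft Coef (Fseq q u))

theorem step_apply (u : Letter) (f : Seq q) : step u f = psum (Fseq q u * f) := rfl

theorem step_mul_step (x y : Letter) (f f' : Seq q) :
    step x f * step y f' =
      step x (f * step y f') + step y (step x f * f') +
        psum (Fseq q x * Fseq q y * (f * f')) := by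
  simp only [step_apply]
  rw [psum_mul_psum]
  congr 1
  · congr 2 <;> ring
  · congr 1; ring

theorem Fseq_d : Fseq q .d = algebraMap Coef (Seq q) Polynomial.X := by
  ext N
  exact (evalCoef_X (q := q)).symm

theorem Fseq_g_mul (k l : ℕ+) : Fseq q (.g k) * Fseq q (.g l) = Fseq q (.g (k + l)) := by
  ext N
  simp only [Seq.mul_apply, Fseq, F, PNat.add_coe, pow_add, add_mul, div_mul_div_comm]

/-- The value F_q(m; ħb) = 1-q does not depend on m, so a collision with ħb leaves the other letter
and a factor ħ. For this reason the spans used for congruences contain multiples of ħ. -/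
theorem psum_d_left (y : Letter) (f : Seq q) :
    psum (Fseq q .d * Fseq q y * f) = (Polynomial.X : Coef) • step y f := by
  rw [step_apply, ← map_smul, Fseq_d, Algebra.smul_def, mul_assoc]

theorem psum_d_right (y : Letter) (f : Seq q) :
    psum (Fseq q y * Fseq q .d * f) = (Polynomial.X : Coef) • step y f := by
  rw [mul_comm (Fseq q y), psum_d_left]

theorem psum_g_g (k l : ℕ+) (f : Seq q) :
    psum (Fseq q (.g k) * Fseq q (.g l) * f) = step (.g (k + l)) f := by
  rw [Fseq_g_mul, step_apply]

/-- The sequence of truncated sums of a word, the head of the list being its last letter. -/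
def wseq (q : ℂ) : List Letter → Seq q
  | [] => 1
  | x :: u => step x (wseq q u)

/-- The word (in reversed order) contains `d`. -/
def hasD : List Letter → Prop
  | [] => False
  | .d :: _ => True
  | .g _ :: u => hasD u

/-- The word (in reversed order) contains `d`, and later a `g_k` with `k ≥ 2`. -/
def pat : List Letter → Prop
  | [] => False
  | .d :: u => pat u
  | .g k :: u => pat u ∨ (2 ≤ k ∧ hasD u)

/-- The word (in reversed order) is empty or ends in some `g_k`. -/
def endG : List Letter → Prop
  | [] => True
  | .d :: _ => False
  | .g _ :: _ => True

/-- Span of the words satisfying `p` and of `ħ` times the words satisfying `p'`. -/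
def wspan (q : ℂ) (p p' : List Letter → Prop) : Submodule Coef (Seq q) :=
  Submodule.span Coef {x | (∃ u, p u ∧ x = wseq q u) ∨
    ∃ u, p' u ∧ x = (Polynomial.X : Coef) • wseq q u}

theorem wseq_mem_wspan {p p' : List Letter → Prop} {u : List Letter} (h : p u) :
    wseq q u ∈ wspan q p p' := Submodule.subset_span (.inl ⟨u, h, rfl⟩)

theorem X_smul_wseq_mem_wspan {p p' : List Letter → Prop} {u : List Letter} (h : p' u) :
    (Polynomial.X : Coef) • wseq q u ∈ wspan q p p' := Submodule.subset_span (.inr ⟨u, h, rfl⟩)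

theorem wspan_le {p p' : List Letter → Prop} {W : Submodule Coef (Seq q)}
    (h : ∀ u, p u → wseq q u ∈ W) (h' : ∀ u, p' u → (Polynomial.X : Coef) • wseq q u ∈ W) :
    wspan q p p' ≤ W := by
  refine Submodule.span_le.mpr ?_
  rintro x (⟨u, hu, rfl⟩ | ⟨u, hu, rfl⟩)
  exacts [h u hu, h' u hu]

theorem mul_mem_of_wspan {p p' r r' : List Letter → Prop} {W : Submodule Coef (Seq q)}
    (h : ∀ u v, p u → (r v ∨ r' v) → wseq q u * wseq q v ∈ W)
    (h' : ∀ u v, p' u → (r v ∨ r' v) → (Polynomial.X : Coef) • (wseq q u * wseq q v) ∈ W)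
    {x y : Seq q} (hx : x ∈ wspan q p p') (hy : y ∈ wspan q r r') : x * y ∈ W := by
  have : wspan q p p' * wspan q r r' ≤ W := by
    rw [wspan, wspan, Submodule.span_mul_span, Submodule.span_le, Set.mul_subset_iff]
    rintro x (⟨u, hu, rfl⟩ | ⟨u, hu, rfl⟩) y (⟨v, hv, rfl⟩ | ⟨v, hv, rfl⟩)
    · exact h u v hu (.inl hv)
    · rw [mul_smul_comm]; exact W.smul_mem _ (h u v hu (.inr hv))
    · rw [smul_mul_assoc]; exact h' u v hu (.inl hv)
    · rw [mul_smul_comm, smul_mul_assoc]; exact W.smul_mem _ (h' u v hu (.inr hv))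
  exact this (Submodule.mul_mem_mul hx hy)

/-- All words. -/
def SA (q : ℂ) := wspan q (fun _ => True) (fun _ => False)
/-- The empty word and the words ending in `g_k`. -/
def SH (q : ℂ) := wspan q endG (fun _ => False)
/-- Words containing `d`, and multiples of `ħ`. -/
def SD (q : ℂ) := wspan q hasD (fun _ => True)
/-- Words with a `d` followed later by `g_k`, `k ≥ 2`, and multiples of `ħ`. -/
def SQ (q : ℂ) := wspan q pat (fun _ => True)
/-- The sequences of the elements of `𝔫`. -/
def SN (q : ℂ) := wspan q (fun u => pat u ∧ endG u) endG

theorem hasD_of_pat : ∀ {u : List Letter}, pat u → hasD u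
  | .d :: _, _ => trivial
  | .g _ :: _, h => h.elim hasD_of_pat And.right

theorem SH_le_SA : SH q ≤ SA q :=
  wspan_le (fun _ _ => wseq_mem_wspan trivial) (fun _ h => h.elim)

theorem SQ_le_SD : SQ q ≤ SD q :=
  wspan_le (fun _ h => wseq_mem_wspan (hasD_of_pat h)) (fun _ _ => X_smul_wseq_mem_wspan trivial)

theorem SN_le_SQ : SN q ≤ SQ q :=
  wspan_le (fun _ h => wseq_mem_wspan h.1) (fun _ _ => X_smul_wseq_mem_wspan trivial)

theorem one_mem_SH : (1 : Seq q) ∈ SH q := wseq_mem_wspan (u := []) trivial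

theorem X_smul_mem_of_le {W : Submodule Coef (Seq q)}
    (h : ∀ u, (Polynomial.X : Coef) • wseq q u ∈ W) {x : Seq q} (hx : x ∈ SA q) :
    (Polynomial.X : Coef) • x ∈ W := by
  have : SA q ≤ W.comap (LinearMap.lsmul Coef (Seq q) Polynomial.X) :=
    wspan_le (fun u _ => h u) (fun _ h => h.elim)
  exact this hx

theorem X_smul_mem_SQ {x : Seq q} (hx : x ∈ SA q) : (Polynomial.X : Coef) • x ∈ SQ q :=
  X_smul_mem_of_le (fun _ => X_smul_wseq_mem_wspan trivial) hx

theorem X_smul_mem_SD {x : Seq q} (hx : x ∈ SA q) : (Polynomial.X : Coef) • x ∈ SD q :=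
  SQ_le_SD (X_smul_mem_SQ hx)

theorem X_smul_mem_SN {x : Seq q} (hx : x ∈ SH q) : (Polynomial.X : Coef) • x ∈ SN q := by
  have : SH q ≤ (SN q).comap (LinearMap.lsmul Coef (Seq q) Polynomial.X) :=
    wspan_le (fun u h => X_smul_wseq_mem_wspan (q := q) h) (fun _ h => h.elim)
  exact this hx

theorem step_mem {p p' r r' : List Letter → Prop} {x : Letter}
    (h : ∀ u, p u → r (x :: u)) (h' : ∀ u, p' u → r' (x :: u))
    {f : Seq q} (hf : f ∈ wspan q p p') : step x f ∈ wspan q r r' := by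
  have : wspan q p p' ≤ (wspan q r r').comap (step x) :=
    wspan_le (fun u hu => wseq_mem_wspan (u := x :: u) (h u hu)) (fun u hu => by
      rw [Submodule.mem_comap, map_smul]
      exact X_smul_wseq_mem_wspan (u := x :: u) (h' u hu))
  exact this hf

theorem step_mem_SA {x : Letter} {f : Seq q} (hf : f ∈ SA q) : step x f ∈ SA q :=
  step_mem (fun _ _ => trivial) (fun _ h => h) hf

theorem step_d_mem_SD {f : Seq q} (hf : f ∈ SA q) : step .d f ∈ SD q :=
  step_mem (fun _ _ => trivial) (fun _ h => h.elim) hf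

theorem step_mem_SD {x : Letter} {f : Seq q} (hf : f ∈ SD q) : step x f ∈ SD q :=
  step_mem (fun _ h => by cases x; exacts [trivial, h]) (fun _ h => h) hf

theorem step_mem_SQ {x : Letter} {f : Seq q} (hf : f ∈ SQ q) : step x f ∈ SQ q :=
  step_mem (fun _ h => by cases x; exacts [h, .inl h]) (fun _ h => h) hf

theorem step_g_mem_SH {k : ℕ+} {f : Seq q} (hf : f ∈ SA q) : step (.g k) f ∈ SH q :=
  step_mem (fun _ _ => trivial) (fun _ h => h) hf

theorem step_g_mem_SN {k : ℕ+} {f : Seq q} (hf : f ∈ SQ q) : step (.g k) f ∈ SN q :=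
  step_mem (fun _ h => ⟨.inl h, trivial⟩) (fun _ _ => trivial) hf

theorem step_g_mem_SN_of_two_le {k : ℕ+} (hk : 2 ≤ k) {f : Seq q} (hf : f ∈ SD q) :
    step (.g k) f ∈ SN q :=
  step_mem (fun _ h => ⟨.inr ⟨hk, h⟩, trivial⟩) (fun _ _ => trivial) hf

theorem two_le_add (k l : ℕ+) : 2 ≤ k + l := add_le_add (_root_.one_le : 1 ≤ k) (_root_.one_le : 1 ≤ l)

/-! ### Harmonic products and the spans of words -/

theorem wseq_cons_mul_wseq_cons (x y : Letter) (u v : List Letter) :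
    wseq q (x :: u) * wseq q (y :: v) =
      step x (wseq q u * wseq q (y :: v)) + step y (wseq q (x :: u) * wseq q v) +
        psum (Fseq q x * Fseq q y * (wseq q u * wseq q v)) :=
  step_mul_step _ _ _ _

/-- The diagonal term amounts to appending a single letter, up to a factor ħ: colliding g_k and g_l
merge into g_{k+l}. -/
theorem psum_mem_of_step {W : Submodule Coef (Seq q)} {f : Seq q} (h : ∀ z, step z f ∈ W)
    (x y : Letter) : psum (Fseq q x * Fseq q y * f) ∈ W := by
  cases x with
  | d => rw [psum_d_left]; exact W.smul_mem _ (h y)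
  | g k => cases y with
    | d => rw [psum_d_right]; exact W.smul_mem _ (h _)
    | g l => rw [psum_g_g]; exact h _

theorem wseq_mul_wseq_mem_SA (u v : List Letter) : wseq q u * wseq q v ∈ SA q := by
  induction u generalizing v with
  | nil => rw [wseq, one_mul]; exact wseq_mem_wspan trivial
  | cons x u ihu =>
    induction v with
    | nil => rw [wseq.eq_def q [], mul_one]; exact wseq_mem_wspan trivial
    | cons y v ihv =>
      rw [wseq_cons_mul_wseq_cons]
      exact add_mem (add_mem (step_mem_SA (ihu _)) (step_mem_SA ihv))
        (psum_mem_of_step (fun _ => step_mem_SA (ihu v)) _ _)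

theorem mul_mem_SA {x y : Seq q} (hx : x ∈ SA q) (hy : y ∈ SA q) : x * y ∈ SA q :=
  mul_mem_of_wspan (fun u v _ _ => wseq_mul_wseq_mem_SA u v) (fun _ _ h => h.elim) hx hy

theorem mul_mem_SH {x y : Seq q} (hx : x ∈ SH q) (hy : y ∈ SH q) : x * y ∈ SH q := by
  refine mul_mem_of_wspan (fun u v hu hv => ?_) (fun _ _ h => h.elim) hx hy
  replace hv : endG v := hv.elim id False.elim
  cases u with
  | nil => rw [wseq, one_mul]; exact wseq_mem_wspan hv
  | cons x u =>
    cases v with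
    | nil => rw [wseq.eq_def q [], mul_one]; exact wseq_mem_wspan hu
    | cons y v =>
      cases x with
      | d => exact hu.elim
      | g k => cases y with
        | d => exact hv.elim
        | g l =>
          rw [wseq_cons_mul_wseq_cons, psum_g_g]
          exact add_mem (add_mem (step_g_mem_SH (wseq_mul_wseq_mem_SA _ _))
            (step_g_mem_SH (wseq_mul_wseq_mem_SA _ _))) (step_g_mem_SH (wseq_mul_wseq_mem_SA _ _))

/-- A letter ħb either survives in each term of the product or is absorbed in a collision, which
leaves a factor ħ. -/
theorem wseq_mul_wseq_mem_SD (u v : List Letter) (hu : hasD u) : wseq q u * wseq q v ∈ SD q := by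
  induction u generalizing v with
  | nil => exact hu.elim
  | cons x u ihu =>
    induction v with
    | nil => rw [wseq.eq_def q [], mul_one]; exact wseq_mem_wspan hu
    | cons y v ihv =>
      rw [wseq_cons_mul_wseq_cons]
      cases x with
      | d =>
        rw [psum_d_left]
        exact add_mem (add_mem (step_d_mem_SD (wseq_mul_wseq_mem_SA _ _)) (step_mem_SD ihv))
          (X_smul_mem_SD (step_mem_SA (wseq_mul_wseq_mem_SA _ _)))
      | g k =>
        exact add_mem (add_mem (step_mem_SD (ihu _ hu)) (step_mem_SD ihv))
          (psum_mem_of_step (fun _ => step_mem_SD (ihu v hu)) _ _)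

theorem mul_mem_SD {x y : Seq q} (hx : x ∈ SD q) (hy : y ∈ SA q) : x * y ∈ SD q :=
  mul_mem_of_wspan (fun u v hu _ => wseq_mul_wseq_mem_SD u v hu)
    (fun _ _ _ _ => X_smul_mem_SD (wseq_mul_wseq_mem_SA _ _)) hx hy

/-- Collisions with some g_l only raise the exponent of a letter g_k with k ≥ 2, collisions with ħb
give a factor ħ, and the letters before g_k still contain ħb up to multiples of ħ. -/
theorem wseq_mul_wseq_mem_SQ (u v : List Letter) (hu : pat u) : wseq q u * wseq q v ∈ SQ q := by
  induction u generalizing v with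
  | nil => exact hu.elim
  | cons x u ihu =>
    induction v with
    | nil => rw [wseq.eq_def q [], mul_one]; exact wseq_mem_wspan hu
    | cons y v ihv =>
      rw [wseq_cons_mul_wseq_cons]
      have key (hu : pat u) := add_mem (add_mem (step_mem_SQ (x := x) (ihu (y :: v) hu))
        (step_mem_SQ (x := y) ihv)) (psum_mem_of_step (fun _ => step_mem_SQ (ihu v hu)) x y)
      cases x with
      | d => exact key hu
      | g k =>
        rcases hu with hu | ⟨hk, hu⟩
        · exact key hu
        · refine add_mem (add_mem (SN_le_SQ (step_g_mem_SN_of_two_le hk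
            (wseq_mul_wseq_mem_SD _ _ hu))) (step_mem_SQ ihv)) ?_
          cases y with
          | d =>
            rw [psum_d_right]
            exact X_smul_mem_SQ (step_mem_SA (wseq_mul_wseq_mem_SA _ _))
          | g l =>
            rw [psum_g_g]
            exact SN_le_SQ (step_g_mem_SN_of_two_le (two_le_add k l) (wseq_mul_wseq_mem_SD _ _ hu))

/-- When both words end in some g_k, so does every term of the product. The weaker span `SQ`
suffices for what precedes the last letter. -/
theorem mul_mem_SN {x y : Seq q} (hx : x ∈ SN q) (hy : y ∈ SH q) : x * y ∈ SN q := by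
  refine mul_mem_of_wspan (fun u v hu hv => ?_) (fun u v hu hv => ?_) hx hy <;>
    replace hv : endG v := hv.elim id False.elim
  · obtain ⟨hp, hu⟩ := hu
    cases u with
    | nil => exact hp.elim
    | cons x u =>
      cases v with
      | nil => rw [wseq.eq_def q [], mul_one]; exact wseq_mem_wspan ⟨hp, hu⟩
      | cons y v =>
        cases x with
        | d => exact hu.elim
        | g k => cases y with
          | d => exact hv.elim
          | g l =>
            rw [wseq_cons_mul_wseq_cons, psum_g_g]
            refine add_mem (add_mem ?_ (step_g_mem_SN (wseq_mul_wseq_mem_SQ _ _ hp))) ?_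
            · rcases hp with hp | ⟨hk, hd⟩
              · exact step_g_mem_SN (wseq_mul_wseq_mem_SQ _ _ hp)
              · exact step_g_mem_SN_of_two_le hk (wseq_mul_wseq_mem_SD _ _ hd)
            · exact step_g_mem_SN_of_two_le (two_le_add k l)
                (wseq_mul_wseq_mem_SD _ _ (hp.elim hasD_of_pat And.right))
  · exact X_smul_mem_SN (mul_mem_SH (wseq_mem_wspan hu) (wseq_mem_wspan hv))

/-! ### Truncated sums of words -/

open Classical in
-- The largest index is split off; it becomes the strict bound for the remaining ones.
theorem sum_strictMono_succ {n : ℕ} (c : Fin (n + 1) → ℕ → ℂ) (M : ℕ) :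
    ∑ m ∈ (Fintype.piFinset fun _ : Fin (n + 1) => Finset.Ioo 0 M).filter
        (fun m => StrictMono m), ∏ i, c i (m i) =
      ∑ k ∈ Finset.Ioo 0 M, c (Fin.last n) k *
        ∑ m ∈ (Fintype.piFinset fun _ : Fin n => Finset.Ioo 0 k).filter
          (fun m => StrictMono m), ∏ i, c i.castSucc (m i) := by
  simp only [Finset.mul_sum]
  rw [Finset.sum_sigma']
  refine Finset.sum_bij' (fun m _ => ⟨m (Fin.last n), Fin.init m⟩)
    (fun x _ => Fin.snoc (α := fun _ => ℕ) x.2 x.1) ?_ ?_ ?_ ?_ ?_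
  · intro m hm
    simp only [Finset.mem_filter, Fintype.mem_piFinset, Finset.mem_Ioo, Finset.mem_sigma,
      Fin.init] at hm ⊢
    exact ⟨hm.1 _, fun i => ⟨(hm.1 _).1, hm.2 (Fin.castSucc_lt_last i)⟩,
      fun i j hij => hm.2 (by simpa using hij)⟩
  · rintro ⟨k, m⟩ hm
    simp only [Finset.mem_filter, Fintype.mem_piFinset, Finset.mem_Ioo, Finset.mem_sigma] at hm ⊢
    refine ⟨fun i => ?_, fun i j hij => ?_⟩
    · induction i using Fin.lastCases with
      | last => simpa using hm.1
      | cast i =>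
        rw [Fin.snoc_castSucc]
        exact ⟨(hm.2.1 i).1, (hm.2.1 i).2.trans hm.1.2⟩
    · induction j using Fin.lastCases with
      | last =>
        induction i using Fin.lastCases with
        | last => exact absurd hij (lt_irrefl _)
        | cast i =>
          rw [Fin.snoc_castSucc, Fin.snoc_last]
          exact (hm.2.1 i).2
      | cast j =>
        induction i using Fin.lastCases with
        | last => exact absurd hij (not_lt.mpr (Fin.le_last _))
        | cast i =>
          rw [Fin.snoc_castSucc, Fin.snoc_castSucc]
          exact hm.2.2 (by simpa using hij)
  · intro m _
    exact Fin.snoc_init_self m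
  · rintro ⟨k, m⟩ _
    simp
  · intro m _
    rw [Fin.prod_univ_castSucc, mul_comm]
    rfl

open Classical in
theorem wordSum_eq (M : ℕ) (u : List Letter) {n : ℕ} (h : u.length = n) :
    wordSum q M u = ∑ m ∈ (Fintype.piFinset fun _ : Fin n => Finset.Ioo 0 M).filter
      (fun m => StrictMono m), ∏ i : Fin n, F q (m i) (u.get (i.cast h.symm)) := by
  subst h; rfl

theorem wordSum_nil (M : ℕ) : wordSum q M [] = 1 := by
  classical
  rw [wordSum_eq M [] (n := 0) rfl, Finset.filter_true_of_mem fun m _ i => Fin.elim0 i]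
  simp

theorem wordSum_append_singleton (M : ℕ) (u : List Letter) (x : Letter) :
    wordSum q M (u ++ [x]) = ∑ k ∈ Finset.Ioo 0 M, F q k x * wordSum q k u := by
  classical
  rw [wordSum_eq M (u ++ [x]) (n := u.length + 1) (by simp),
    sum_strictMono_succ (fun i k => F q k ((u ++ [x]).get (i.cast (by simp))))]
  refine Finset.sum_congr rfl fun k _ => ?_
  rw [wordSum_eq k u rfl]
  congr 1
  · simp
  · refine Finset.sum_congr rfl fun m _ => Finset.prod_congr rfl fun i _ => ?_
    simp

theorem wordSum_reverse (N : ℕ) (u : List Letter) : wordSum q (N + 1) u.reverse = wseq q u N := by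
  induction u generalizing N with
  | nil => rw [List.reverse_nil, wordSum_nil]; rfl
  | cons x u ih =>
    rw [List.reverse_cons, wordSum_append_singleton, wseq, step_apply, psum_apply]
    have : Finset.Ioo 0 (N + 1) = (Finset.range N).image (· + 1) := by
      ext k
      simp only [Finset.mem_Ioo, Finset.mem_image, Finset.mem_range]
      exact ⟨fun h => ⟨k - 1, by omega, by omega⟩, by rintro ⟨n, h, rfl⟩; omega⟩
    rw [this, Finset.sum_image fun _ _ _ _ h => Nat.succ_injective h]
    exact Finset.sum_congr rfl fun n _ => by rw [ih, Seq.mul_apply, Fseq]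

/-! ### The free algebra on the letters and its action on sequences -/

/-- The free algebra on the letters. -/
abbrev LA := FreeAlgebra Coef Letter

/-- The letters as elements of the free algebra. -/
def li (x : Letter) : LA := FreeAlgebra.ι Coef x

/-- The word with reversed list `u`. -/
def hw : List Letter → LA
  | [] => 1
  | x :: u => hw u * li x

/-- The right action of the free algebra on sequences, by appending letters. -/
def act (q : ℂ) : LA →ₐ[Coef] (Module.End Coef (Seq q))ᵐᵒᵖ :=
  FreeAlgebra.lift Coef fun u => MulOpposite.op (step u)

/-- Appending `x` to a word, on the level of truncated sums. -/
def app (x : LA) : Seq q →ₗ[Coef] Seq q := (act q x).unop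

theorem app_li (x : Letter) : app (q := q) (li x) = step x := by
  simp [app, act, li]

theorem app_mul (x y : LA) (f : Seq q) : app (x * y) f = app y (app x f) := by
  simp [app]

theorem app_one (f : Seq q) : app 1 f = f := by
  simp [app]

theorem app_add (x y : LA) (f : Seq q) : app (x + y) f = app x f + app y f := by
  simp [app]

theorem app_smul (c : Coef) (x : LA) (f : Seq q) : app (c • x) f = c • app x f := by
  simp [app]

theorem app_sum {ι : Type*} (s : Finset ι) (x : ι → LA) (f : Seq q) :
    app (∑ i ∈ s, x i) f = ∑ i ∈ s, app (x i) f := by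
  simp [app]

theorem app_pow (x : LA) (n : ℕ) (f : Seq q) : app (x ^ n) f = ((app x) ^ n) f := by
  simp [app]

/-- The sequence of truncated sums of an element of the free algebra. -/
def zl (q : ℂ) : LA →ₗ[Coef] Seq q where
  toFun x := app x 1
  map_add' x y := app_add x y 1
  map_smul' c x := app_smul c x 1

theorem zl_mul (x y : LA) : zl q (x * y) = app y (zl q x) := app_mul x y 1

theorem zl_one : zl q 1 = 1 := app_one 1

theorem zl_hw (u : List Letter) : zl q (hw u) = wseq q u := by
  induction u with
  | nil => exact zl_one
  | cons x u ih => rw [hw, zl_mul, ih, app_li, wseq]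

theorem basis_eq_hw (u : List Letter) :
    FreeAlgebra.basisFreeMonoid Coef Letter (FreeMonoid.ofList u) = hw u.reverse := by
  rw [basis_eq, FreeMonoid.lift_ofList]
  induction u using List.reverseRecOn with
  | nil => rfl
  | append_singleton u x ih =>
    rw [List.map_append, List.prod_append, ih, List.reverse_append]
    simp [hw, li]

theorem span_hw : Submodule.span Coef (Set.range hw) = ⊤ := by
  rw [← (FreeAlgebra.basisFreeMonoid Coef Letter).span_eq]
  congr 1
  ext w
  constructor
  · rintro ⟨l, rfl⟩
    exact ⟨FreeMonoid.ofList l.reverse, by rw [basis_eq_hw, List.reverse_reverse]⟩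
  · rintro ⟨u, rfl⟩
    exact ⟨(FreeMonoid.toList u).reverse, by rw [← basis_eq_hw]; rfl⟩

theorem freeZ_add (M : ℕ) (x y : LA) : freeZ q M (x + y) = freeZ q M x + freeZ q M y := by
  rw [freeZ, map_add, Finsupp.sum_add_index']
  · rfl
  · simp
  · intro u c c'; rw [map_add, add_mul]

theorem freeZ_smul (M : ℕ) (c : Coef) (x : LA) :
    freeZ q M (c • x) = evalCoef q c * freeZ q M x := by
  rw [freeZ, map_smul, Finsupp.sum_smul_index' (by simp), freeZ, Finsupp.mul_sum]
  simp only [smul_eq_mul, map_mul, mul_assoc]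

theorem freeZ_eq (N : ℕ) (x : LA) : freeZ q (N + 1) x = zl q x N := by
  have hx : x ∈ Submodule.span Coef (Set.range hw) := by rw [span_hw]; trivial
  induction hx using Submodule.span_induction with
  | zero => rw [map_zero, freeZ, map_zero]; rfl
  | add x y _ _ hx hy => rw [freeZ_add, hx, hy, map_add, Seq.add_apply]
  | smul c x _ hx => rw [freeZ_smul, hx, map_smul, Seq.smul_apply]
  | mem x hx =>
    obtain ⟨u, rfl⟩ := hx
    rw [zl_hw, ← wordSum_reverse, ← List.reverse_reverse u, ← basis_eq_hw, freeZ]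
    simp

theorem ZM_toH (N : ℕ) (x : LA) : ZM q (N + 1) (toH x) = zl q x N := by
  rw [ZM, toH_injective.extend_apply, freeZ_eq]

theorem toH_li (x : Letter) : toH (li x) = x.val := by
  simp [toH, li]

theorem toH_li_d : toH (li .d) = hbar * b := toH_li _

theorem toH_li_g (k : ℕ+) : toH (li (.g k)) = g k := toH_li _

/-! ### Spans of words -/

/-- Span of the words satisfying `p` and of `ħ` times the words satisfying `p'`, in the free
algebra on the letters. -/
def lspan (p p' : List Letter → Prop) : Submodule Coef LA :=
  Submodule.span Coef {x | (∃ u, p u ∧ x = hw u) ∨ ∃ u, p' u ∧ x = (Polynomial.X : Coef) • hw u}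

theorem hw_mem_lspan {p p' : List Letter → Prop} {u : List Letter} (h : p u) :
    hw u ∈ lspan p p' := Submodule.subset_span (.inl ⟨u, h, rfl⟩)

theorem X_smul_hw_mem_lspan {p p' : List Letter → Prop} {u : List Letter} (h : p' u) :
    (Polynomial.X : Coef) • hw u ∈ lspan p p' := Submodule.subset_span (.inr ⟨u, h, rfl⟩)

theorem lspan_le {p p' : List Letter → Prop} {W : Submodule Coef LA}
    (h : ∀ u, p u → hw u ∈ W) (h' : ∀ u, p' u → (Polynomial.X : Coef) • hw u ∈ W) :
    lspan p p' ≤ W := by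
  refine Submodule.span_le.mpr ?_
  rintro x (⟨u, hu, rfl⟩ | ⟨u, hu, rfl⟩)
  exacts [h u hu, h' u hu]

theorem map_lspan (p p' : List Letter → Prop) : (lspan p p').map (zl q) = wspan q p p' := by
  apply le_antisymm
  · rw [Submodule.map_le_iff_le_comap]
    exact lspan_le (fun u hu => by rw [Submodule.mem_comap, zl_hw]; exact wseq_mem_wspan hu)
      (fun u hu => by
        rw [Submodule.mem_comap, map_smul, zl_hw]; exact X_smul_wseq_mem_wspan hu)
  · exact wspan_le (fun u hu => ⟨hw u, hw_mem_lspan hu, zl_hw u⟩)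
      (fun u hu => ⟨_, X_smul_hw_mem_lspan hu, by rw [map_smul, zl_hw]⟩)

theorem mul_mem_lspan {p p' r r' s s' : List Letter → Prop}
    (h1 : ∀ u v, p u → r v → s (v ++ u)) (h2 : ∀ u v, p u → r' v → s' (v ++ u))
    (h3 : ∀ u v, p' u → r v → s' (v ++ u)) (h4 : ∀ u v, p' u → r' v → s' (v ++ u))
    {x y : LA} (hx : x ∈ lspan p p') (hy : y ∈ lspan r r') : x * y ∈ lspan s s' := by
  have hmul : ∀ u v, hw u * hw v = hw (v ++ u) := by
    intro u v
    induction v with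
    | nil => exact mul_one _
    | cons x v ih => rw [hw, ← mul_assoc, ih]; rfl
  have : lspan p p' * lspan r r' ≤ lspan s s' := by
    rw [lspan, lspan, Submodule.span_mul_span, Submodule.span_le, Set.mul_subset_iff]
    rintro x (⟨u, hu, rfl⟩ | ⟨u, hu, rfl⟩) y (⟨v, hv, rfl⟩ | ⟨v, hv, rfl⟩)
    · rw [hmul]; exact hw_mem_lspan (h1 u v hu hv)
    · rw [mul_smul_comm, hmul]; exact X_smul_hw_mem_lspan (h2 u v hu hv)
    · rw [smul_mul_assoc, hmul]; exact X_smul_hw_mem_lspan (h3 u v hu hv)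
    · rw [mul_smul_comm, smul_mul_assoc, hmul]
      exact Submodule.smul_mem _ _ (X_smul_hw_mem_lspan (h4 u v hu hv))
  exact this (Submodule.mul_mem_mul hx hy)

/-- Span of the words ending in `g_k` and of the empty word. -/
def LH : Submodule Coef LA := lspan endG (fun _ => False)
/-- Span of the words containing `d` and of the multiples of `ħ`. -/
def LD : Submodule Coef LA := lspan hasD (fun _ => True)
/-- The counterpart of `𝔫` in the free algebra. -/
def LN : Submodule Coef LA := lspan (fun u => pat u ∧ endG u) endG

theorem map_LH : LH.map (zl q) = SH q := map_lspan _ _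
theorem map_LN : LN.map (zl q) = SN q := map_lspan _ _

theorem lspan_true : lspan (fun _ => True) (fun _ => False) = ⊤ := by
  rw [eq_top_iff, ← span_hw, Submodule.span_le]
  rintro _ ⟨u, rfl⟩
  exact hw_mem_lspan trivial

theorem mem_lspan_true (x : LA) : x ∈ lspan (fun _ => True) (fun _ => False) := by
  rw [lspan_true]; trivial

theorem zl_mem_SA (x : LA) : zl q x ∈ SA q := by
  rw [SA, ← map_lspan]; exact ⟨x, mem_lspan_true x, rfl⟩

theorem one_mem_LH : (1 : LA) ∈ LH := hw_mem_lspan (u := []) trivial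

theorem li_g_mem_LH (k : ℕ+) : li (.g k) ∈ LH := by
  have := hw_mem_lspan (p := endG) (p' := fun _ => False) (u := [.g k]) trivial
  rwa [hw, hw, one_mul] at this

theorem endG_append {u v : List Letter} (hu : endG u) (hv : endG v) : endG (v ++ u) := by
  cases v with
  | nil => exact hu
  | cons x v => cases x; exacts [hv.elim, trivial]

theorem hasD_append_left : ∀ {v : List Letter} (u : List Letter), hasD v → hasD (v ++ u)
  | .d :: _, _, _ => trivial
  | .g _ :: v, u, h => hasD_append_left (v := v) u h

theorem hasD_append_right {u : List Letter} : ∀ v : List Letter, hasD u → hasD (v ++ u)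
  | [], h => h
  | .d :: _, _ => trivial
  | .g _ :: v, h => hasD_append_right v h

theorem pat_append_left : ∀ {v : List Letter} (u : List Letter), pat v → pat (v ++ u)
  | .d :: v, u, h => pat_append_left (v := v) u h
  | .g _ :: v, u, h => h.imp (pat_append_left (v := v) u) (And.imp_right (hasD_append_left u))

theorem pat_append_right {u : List Letter} : ∀ v : List Letter, pat u → pat (v ++ u)
  | [], h => h
  | .d :: v, h => pat_append_right v h
  | .g _ :: v, h => .inl (pat_append_right v h)

theorem mul_mem_LH {x y : LA} (hx : x ∈ LH) (hy : y ∈ LH) : x * y ∈ LH :=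
  mul_mem_lspan (fun _ _ hu hv => endG_append hu hv) (fun _ _ _ h => h.elim)
    (fun _ _ h => h.elim) (fun _ _ h => h.elim) hx hy

theorem mul_li_g_mem_LH (x : LA) (k : ℕ+) : x * li (.g k) ∈ LH := by
  have h : li (.g k) ∈ lspan (fun v => v = [.g k]) (fun _ => False) := by
    have := hw_mem_lspan (p := fun v => v = [.g k]) (p' := fun _ => False) rfl
    rwa [hw, hw, one_mul] at this
  exact mul_mem_lspan (fun _ _ _ hv => by subst hv; trivial) (fun _ _ _ h => h.elim)
    (fun _ _ h => h.elim) (fun _ _ h => h.elim) (mem_lspan_true x) h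

theorem mul_mem_LN_left {x y : LA} (hx : x ∈ LN) (hy : y ∈ LH) : x * y ∈ LN :=
  mul_mem_lspan (fun _ v hu hv => ⟨pat_append_right v hu.1, endG_append hu.2 hv⟩)
    (fun _ _ _ h => h.elim) (fun _ _ hu hv => endG_append hu hv) (fun _ _ _ h => h.elim) hx hy

theorem X_smul_mem_LN {x : LA} (hx : x ∈ LH) : (Polynomial.X : Coef) • x ∈ LN := by
  have : LH ≤ LN.comap (LinearMap.lsmul Coef LA Polynomial.X) :=
    lspan_le (fun u h => X_smul_hw_mem_lspan h) (fun _ h => h.elim)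
  exact this hx

theorem mul_li_g_mem_LN {x : LA} (hx : x ∈ LD) {k : ℕ+} (hk : 2 ≤ k) : x * li (.g k) ∈ LN := by
  have h : li (.g k) ∈ lspan (fun v => v = [.g k]) (fun _ => False) := by
    have := hw_mem_lspan (p := fun v => v = [.g k]) (p' := fun _ => False) rfl
    rwa [hw, hw, one_mul] at this
  exact mul_mem_lspan (fun _ _ hu hv => by subst hv; exact ⟨.inr ⟨hk, hu⟩, trivial⟩)
    (fun _ _ _ h => h.elim) (fun _ _ _ hv => by subst hv; trivial)
    (fun _ _ _ h => h.elim) hx h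

theorem mul_mem_LN_right {x y : LA} (hx : x ∈ LH) (hy : y ∈ LN) : x * y ∈ LN :=
  mul_mem_lspan (fun _ _ hu hv => ⟨pat_append_left _ hv.1, endG_append hu hv.2⟩)
    (fun _ _ hu hv => endG_append hu hv) (fun _ _ h => h.elim) (fun _ _ h => h.elim) hx hy

theorem LN_le_LH : LN ≤ LH :=
  lspan_le (fun _ h => hw_mem_lspan h.2) (fun _ h => Submodule.smul_mem _ _ (hw_mem_lspan h))

theorem HHat_eq : HHat = LH.map toH.toLinearMap := by
  apply le_antisymm
  · refine sup_le ?_ (iSup_le fun k => ?_)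
    · rw [Submodule.one_le]
      exact ⟨1, one_mem_LH, map_one toH⟩
    · rintro _ ⟨w, hw, rfl⟩
      have hw' : w ∈ CA := hw
      rw [← range_toH] at hw'
      obtain ⟨x, rfl⟩ := hw'
      exact ⟨x * li (.g k), mul_li_g_mem_LH x k, (map_mul toH _ _).trans (by rw [toH_li_g]; rfl)⟩
  · rw [Submodule.map_le_iff_le_comap]
    refine lspan_le (fun u hu => ?_) (fun _ h => h.elim)
    cases u with
    | nil =>
      refine Submodule.mem_sup_left ?_
      rw [hw, AlgHom.toLinearMap_apply, map_one]
      exact Submodule.one_le.mp le_rfl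
    | cons x u =>
      cases x with
      | d => exact hu.elim
      | g k =>
        refine Submodule.mem_sup_right (Submodule.mem_iSup_of_mem k ⟨toH (hw u), ?_, ?_⟩)
        · change toH (hw u) ∈ CA
          rw [← range_toH]; exact ⟨_, rfl⟩
        · simp [hw, toH_li_g]

theorem toH_mem_HHat {x : LA} (hx : x ∈ LH) : toH x ∈ HHat := by
  rw [HHat_eq]; exact ⟨x, hx, rfl⟩

theorem monomial_append_singleton (l : List (ℕ × ℕ)) (p : ℕ × ℕ) :
    monomial (l ++ [p]) = monomial l * ((e 1 - g 1) ^ p.1 * g (p.2 + 1)) := by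
  simp [monomial]

/-- The condition on the exponents in the definition of `𝔫₀`. -/
def lpat (l : List (ℕ × ℕ)) : Prop :=
  ∃ s t : Fin l.length, s ≤ t ∧ 1 ≤ (l.get s).1 ∧ 1 ≤ (l.get t).2

/-- Some exponent `α_s` is positive. -/
def lhasD (l : List (ℕ × ℕ)) : Prop := ∃ s : Fin l.length, 1 ≤ (l.get s).1

theorem lpat_append {l : List (ℕ × ℕ)} (h : lpat l) (p : ℕ × ℕ) : lpat (l ++ [p]) := by
  obtain ⟨s, t, hst, hs, ht⟩ := h
  refine ⟨s.castLE (by simp), t.castLE (by simp), hst, ?_, ?_⟩ <;> simpa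

theorem lhasD_append {l : List (ℕ × ℕ)} (h : lhasD l) (p : ℕ × ℕ) : lhasD (l ++ [p]) := by
  obtain ⟨s, hs⟩ := h
  exact ⟨s.castLE (by simp), by simpa⟩

theorem lhasD_append_singleton {l : List (ℕ × ℕ)} {p : ℕ × ℕ} (h : 1 ≤ p.1) :
    lhasD (l ++ [p]) := ⟨⟨l.length, by simp⟩, by simpa⟩

theorem lpat_append_singleton {l : List (ℕ × ℕ)} {p : ℕ × ℕ} (h : lhasD (l ++ [p]))
    (hp : 1 ≤ p.2) : lpat (l ++ [p]) := by
  obtain ⟨s, hs⟩ := h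
  refine ⟨s, ⟨l.length, by simp⟩, ?_, hs, by simpa⟩
  have := s.2
  simp only [List.length_append, List.length_singleton] at this
  exact Fin.mk_le_mk.mpr (by omega)

/-- The word is cut after each g_k. The number `α` counts the letters ħb not yet followed by any
g_k; the next g_k closes this run and contributes the pair (α, k-1). -/
theorem exists_monomial (u : List Letter) : ∃ (l : List (ℕ × ℕ)) (α : ℕ),
    toH (hw u) = monomial l * (e 1 - g 1) ^ α ∧ (endG u → α = 0) ∧
      (hasD u → lhasD l ∨ 1 ≤ α) ∧ (pat u → lpat l) := by
  induction u with
  | nil => exact ⟨[], 0, by simp [hw, monomial], fun _ => rfl, fun h => h.elim, fun h => h.elim⟩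
  | cons x u ih =>
    obtain ⟨l, α, h, -, hD, hP⟩ := ih
    cases x with
    | d =>
      refine ⟨l, α + 1, ?_, fun h => h.elim, fun _ => .inr (Nat.le_add_left 1 α), hP⟩
      rw [hw, map_mul, h, toH_li_d, e_one_sub_g_one, pow_succ, mul_assoc]
    | g k =>
      have hk : (k : ℕ) - 1 + 1 = k := Nat.sub_add_cancel k.2
      have hD' (hu : hasD u) : lhasD (l ++ [(α, (k : ℕ) - 1)]) :=
        (hD hu).elim (fun h => lhasD_append h _) (fun h => lhasD_append_singleton h)
      refine ⟨l ++ [(α, (k : ℕ) - 1)], 0, ?_, fun _ => rfl, fun hu => .inl (hD' hu), ?_⟩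
      · rw [hw, map_mul, h, toH_li_g, monomial_append_singleton, hk, pow_zero, mul_one, mul_assoc]
      · rintro (hu | ⟨hk2, hu⟩)
        · exact lpat_append (hP hu) _
        · have : (2 : ℕ) ≤ k := hk2
          exact lpat_append_singleton (hD' hu) (by simp only; omega)

theorem toH_mem_nn {x : LA} (hx : x ∈ LN) : toH x ∈ nn := by
  have : LN ≤ nn.comap toH.toLinearMap := by
    refine lspan_le (fun u hu => ?_) (fun u hu => ?_)
    · obtain ⟨l, α, h, hα, -, hP⟩ := exists_monomial u
      rw [hα hu.2, pow_zero, mul_one] at h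
      exact Submodule.mem_sup_left (Submodule.subset_span ⟨l, hP hu.1, h⟩)
    · rw [Submodule.mem_comap, map_smul]
      refine Submodule.mem_sup_right (Submodule.smul_mem_pointwise_smul _ _ _ ?_)
      exact toH_mem_HHat (hw_mem_lspan hu)
  exact this hx

/-! ### Shuffle products of words in `ħ b` and `g_1` -/

theorem rat_smul_eq (r : ℚ) (w : H) : r • w = (Polynomial.C r : Coef) • w :=
  (IsScalarTower.algebraMap_smul Coef r w).symm

theorem hbar_mul_eq (w : H) : hbar * w = (Polynomial.X : Coef) • w :=
  (Algebra.smul_def _ _).symm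

theorem g_one : g 1 = b * a := by rw [g, pow_one]

theorem sh_mul_d (w w' : H) : sh w (w' * (hbar * b)) = sh w w' * (hbar * b) := by
  simp only [hbar_mul_eq, mul_smul_comm, map_smul, sh_mul_b]

theorem mul_d_sh (w w' : H) : sh (w * (hbar * b)) w' = sh w w' * (hbar * b) := by
  simp only [hbar_mul_eq, mul_smul_comm, map_smul, LinearMap.smul_apply, mul_b_sh]

/-- The letters b leave the shuffle on the right, so the term with ħ in the rule for a turns into a
letter ħb. Hence words in ħb and g_1 are closed under the shuffle product. -/
theorem mul_g_one_sh_mul_g_one (w w' : H) : sh (w * g 1) (w' * g 1) =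
    (sh (w * g 1) w' + sh w (w' * g 1) + sh w w' * (hbar * b)) * g 1 := by
  have h := mul_a_sh_mul_a (w * b) (w' * b)
  simp only [mul_assoc w, mul_assoc w', ← g_one] at h
  rw [h, sh_mul_b, mul_b_sh, mul_b_sh, sh_mul_b]
  simp only [hbar_mul_eq, mul_smul_comm, smul_mul_assoc, g_one, add_mul, mul_assoc]

theorem sh_g_one_mul_d_pow (w : H) (i : ℕ) :
    sh (g 1) (w * (hbar * b) ^ i) = sh (g 1) w * (hbar * b) ^ i := by
  induction i with
  | zero => simp
  | succ i ih => rw [pow_succ, ← mul_assoc, sh_mul_d, ih, mul_assoc]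

theorem sh_g_one_mul_g_one (w : H) :
    sh (g 1) (w * g 1) = sh (g 1) w * g 1 + w * g 1 * g 1 + w * (hbar * b) * g 1 := by
  have h := mul_g_one_sh_mul_g_one 1 w
  rw [one_mul, one_sh, one_sh] at h
  rw [h, add_mul, add_mul]

/-- The coefficient `1 / (i + 1)!`. -/
def cinv (i : ℕ) : Coef := Polynomial.C (1 / ((i + 1).factorial : ℚ))

theorem cinv_zero : cinv 0 = 1 := by simp [cinv]

theorem cinv_succ (i : ℕ) : ((i + 2 : ℕ) : Coef) * cinv (i + 1) = cinv i := by
  have h : ((i + 2 : ℕ) : Coef) = Polynomial.C ((i + 2 : ℕ) : ℚ) :=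
    (map_natCast Polynomial.C _).symm
  rw [cinv, cinv, h, ← Polynomial.C_mul]
  congr 1
  rw [Nat.factorial_succ (i + 1)]
  have := Nat.cast_ne_zero (R := ℚ).mpr (Nat.factorial_ne_zero (i + 1))
  push_cast
  field_simp
  ring

/-- The coefficients of `exp_sh(g_1 X)` in the free algebra on the letters. -/
def dA : ℕ → LA
  | 0 => 1
  | n + 1 => ∑ p ∈ (antidiagonal n).attach,
      cinv p.1.1 • (dA p.1.2 * (li .d ^ p.1.1 * li (.g 1)))
decreasing_by
  have := Finset.HasAntidiagonal.mem_antidiagonal.mp p.2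
  omega

theorem dA_zero : dA 0 = 1 := by rw [dA]

/-- In terms of series with d = ħb: ∑ `dA n` X^n is the inverse of 1 - ((e^{dX}-1)/d) g_1 under
concatenation. -/
theorem dA_succ (n : ℕ) : dA (n + 1) = ∑ p ∈ antidiagonal n,
    cinv p.1 • (dA p.2 * (li .d ^ p.1 * li (.g 1))) := by
  rw [dA, Finset.sum_attach (antidiagonal n)
    (fun p => cinv p.1 • (dA p.2 * (li .d ^ p.1 * li (.g 1))))]

theorem toH_dA_succ (n : ℕ) : toH (dA (n + 1)) = ∑ p ∈ antidiagonal n,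
    cinv p.1 • (toH (dA p.2) * (hbar * b) ^ p.1 * g 1) := by
  rw [dA_succ, map_sum]
  refine Finset.sum_congr rfl fun p _ => ?_
  rw [map_smul, map_mul, map_mul, map_pow, toH_li_d, toH_li_g, mul_assoc]
  rfl

/-- This is the differential equation f' = g_1 sh f, which together with the constant term 1
determines exp_sh(g_1X). -/
theorem sh_g_one_dA (n : ℕ) : sh (g 1) (toH (dA n)) = ((n + 1 : ℕ) : Coef) • toH (dA (n + 1)) := by
  induction n using Nat.strong_induction_on with
  | _ n ih =>
    cases n with
    | zero =>
      rw [toH_dA_succ, dA_zero, map_one, sh_one]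
      simp [cinv_zero, dA_zero]
    | succ n =>
      have h1 : sh (g 1) (toH (dA (n + 1))) = ∑ p ∈ antidiagonal n,
          (((p.2 + 1 : ℕ) : Coef) • cinv p.1 • (toH (dA (p.2 + 1)) * (hbar * b) ^ p.1 * g 1)) +
          toH (dA (n + 1)) * g 1 +
          ∑ p ∈ antidiagonal n,
            cinv p.1 • (toH (dA p.2) * (hbar * b) ^ (p.1 + 1) * g 1) := by
        rw [toH_dA_succ n, map_sum, Finset.sum_mul, ← Finset.sum_add_distrib,
          ← Finset.sum_add_distrib]
        refine Finset.sum_congr rfl fun p hp => ?_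
        have hp' := Finset.HasAntidiagonal.mem_antidiagonal.mp hp
        rw [map_smul, sh_g_one_mul_g_one, sh_g_one_mul_d_pow, ih p.2 (by omega), pow_succ]
        simp only [smul_add, smul_mul_assoc, mul_assoc]
        rw [smul_comm]
      -- The factor n+2 is split as `p.2 + (p.1 + 1)`. The first part matches g_1 shuffled into `dA
      -- p.2`. In the second, `p.1 = 0` gives the term ending in g_1 g_1, and the others match the
      -- terms with an additional ħb through (i+2)/(i+2)! = 1/(i+1)!.
      have h2 : ((n + 2 : ℕ) : Coef) • toH (dA (n + 2)) =
          ∑ p ∈ antidiagonal (n + 1), ((p.2 : ℕ) : Coef) • cinv p.1 •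
            (toH (dA p.2) * (hbar * b) ^ p.1 * g 1) +
          ∑ p ∈ antidiagonal (n + 1), ((p.1 + 1 : ℕ) : Coef) • cinv p.1 •
            (toH (dA p.2) * (hbar * b) ^ p.1 * g 1) := by
        rw [toH_dA_succ (n + 1), Finset.smul_sum, ← Finset.sum_add_distrib]
        refine Finset.sum_congr rfl fun p hp => ?_
        have hp' := Finset.HasAntidiagonal.mem_antidiagonal.mp hp
        rw [← add_smul, ← Nat.cast_add]
        congr 2
        omega
      rw [h1, h2, Finset.Nat.sum_antidiagonal_succ', Finset.Nat.sum_antidiagonal_succ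
        (f := fun p => ((p.1 + 1 : ℕ) : Coef) • cinv p.1 •
            (toH (dA p.2) * (hbar * b) ^ p.1 * g 1))]
      simp only [Nat.cast_zero, zero_smul, zero_add, pow_zero, mul_one, Nat.cast_one, one_smul,
        cinv_zero]
      rw [add_assoc]
      congr 2
      refine Finset.sum_congr rfl fun p _ => ?_
      rw [smul_smul, cinv_succ]

theorem shPow_g_one (n : ℕ) : shPow (g 1) n = ((n.factorial : ℕ) : Coef) • toH (dA n) := by
  induction n with
  | zero => rw [shPow, dA_zero, map_one]; simp
  | succ n ih =>
    rw [shPow, ih, map_smul, sh_g_one_dA, smul_smul, ← Nat.cast_mul, Nat.factorial_succ, mul_comm]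

theorem coeff_shSeriesPow (w : H) (j n : ℕ) :
    PowerSeries.coeff n (shSeriesPow (PowerSeries.C w * PowerSeries.X) j) =
      if n = j then shPow w j else 0 := by
  induction j generalizing n with
  | zero => simp [shSeriesPow, shPow, PowerSeries.coeff_one]
  | succ j ih =>
    rw [shSeriesPow, shSeries, PowerSeries.coeff_mk]
    cases n with
    | zero => simp
    | succ n =>
      rw [Finset.Nat.sum_antidiagonal_succ]
      rw [Finset.sum_eq_single (0, n)]
      · simp only [ih, PowerSeries.coeff_C_mul, PowerSeries.coeff_X, shPow]
        by_cases h : n = j <;> simp [h]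
      · rintro ⟨i, l⟩ _ hne
        have : i ≠ 0 := by
          rintro rfl
          simp_all
        simp [PowerSeries.coeff_C, this]
      · simp

theorem coeff_expSh (n : ℕ) :
    PowerSeries.coeff n (expSh (PowerSeries.C (g 1) * PowerSeries.X)) = toH (dA n) := by
  rw [expSh, PowerSeries.coeff_mk, Finset.sum_eq_single n]
  · rw [coeff_shSeriesPow, if_pos rfl, shPow_g_one, rat_smul_eq, smul_smul]
    have h : ((n.factorial : ℕ) : Coef) = Polynomial.C ((n.factorial : ℕ) : ℚ) := by simp
    rw [h, ← Polynomial.C_mul, one_div_mul_cancel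
      (Nat.cast_ne_zero.mpr (Nat.factorial_ne_zero n)), map_one, one_smul]
  · intro j _ hj
    rw [coeff_shSeriesPow, if_neg (Ne.symm hj), smul_zero]
  · simp

theorem dA_mem_LH (n : ℕ) : dA n ∈ LH := by
  cases n with
  | zero => rw [dA_zero]; exact one_mem_LH
  | succ n =>
    rw [dA_succ]
    refine sum_mem fun p _ => Submodule.smul_mem _ _ ?_
    rw [← mul_assoc]
    exact mul_li_g_mem_LH _ _

/-! ### Shuffles of `g_1` and `e_1` modulo words containing `ħ b` -/

/-- All letters of the word are `d` or `g_1`. -/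
def bw (u : List Letter) : Prop := ∀ x ∈ u, x = .d ∨ x = .g 1

/-- Span of the words in `d` and `g_1`. -/
def MB : Submodule Coef H := Submodule.span Coef {w | ∃ u, bw u ∧ w = toH (hw u)}

/-- Span of the words in `d` and `g_1` that contain `d`. -/
def MD : Submodule Coef H := Submodule.span Coef {w | ∃ u, (bw u ∧ hasD u) ∧ w = toH (hw u)}

theorem MD_le_MB : MD ≤ MB :=
  Submodule.span_mono fun _ ⟨u, hu, h⟩ => ⟨u, hu.1, h⟩

theorem toH_hw_cons_d (u : List Letter) : toH (hw (.d :: u)) = toH (hw u) * (hbar * b) := by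
  rw [hw, map_mul, toH_li_d]

theorem toH_hw_cons_g_one (u : List Letter) : toH (hw (.g 1 :: u)) = toH (hw u) * g 1 := by
  rw [hw, map_mul, toH_li_g]; rfl

theorem mul_d_mem_MD {w : H} (h : w ∈ MB) : w * (hbar * b) ∈ MD := by
  have : MB ≤ MD.comap (LinearMap.mulRight Coef (hbar * b)) := by
    refine Submodule.span_le.mpr ?_
    rintro _ ⟨u, hu, rfl⟩
    exact Submodule.subset_span ⟨.d :: u, ⟨List.forall_mem_cons.mpr ⟨.inl rfl, hu⟩, trivial⟩,
      (toH_hw_cons_d u).symm⟩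
  exact this h

theorem mul_g_one_mem_MD {w : H} (h : w ∈ MD) : w * g 1 ∈ MD := by
  have : MD ≤ MD.comap (LinearMap.mulRight Coef (g 1)) := by
    refine Submodule.span_le.mpr ?_
    rintro _ ⟨u, hu, rfl⟩
    exact Submodule.subset_span ⟨.g 1 :: u, ⟨List.forall_mem_cons.mpr ⟨.inr rfl, hu.1⟩, hu.2⟩,
      (toH_hw_cons_g_one u).symm⟩
  exact this h

theorem mul_g_one_mem_MB {w : H} (h : w ∈ MB) : w * g 1 ∈ MB := by
  have : MB ≤ MB.comap (LinearMap.mulRight Coef (g 1)) := by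
    refine Submodule.span_le.mpr ?_
    rintro _ ⟨u, hu, rfl⟩
    exact Submodule.subset_span ⟨.g 1 :: u, List.forall_mem_cons.mpr ⟨.inr rfl, hu⟩,
      (toH_hw_cons_g_one u).symm⟩
  exact this h

theorem one_mem_MB : (1 : H) ∈ MB :=
  Submodule.subset_span ⟨[], fun _ h => absurd h List.not_mem_nil, (map_one toH).symm⟩

theorem g_one_pow_mem_MB (n : ℕ) : g 1 ^ n ∈ MB := by
  induction n with
  | zero => rw [pow_zero]; exact one_mem_MB
  | succ n ih => rw [pow_succ]; exact mul_g_one_mem_MB ih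

/-- A letter ħb leaves the shuffle unchanged, and a collision of two letters g_1 creates a new ħb,
so none is ever lost. -/
theorem sh_word_mem (u v : List Letter) (hu : bw u) (hv : bw v) :
    sh (toH (hw u)) (toH (hw v)) ∈ MB ∧
      (hasD u ∨ hasD v → sh (toH (hw u)) (toH (hw v)) ∈ MD) := by
  induction u generalizing v with
  | nil =>
    rw [hw, map_one, one_sh]
    exact ⟨Submodule.subset_span ⟨v, hv, rfl⟩, fun h =>
      Submodule.subset_span ⟨v, ⟨hv, h.elim False.elim id⟩, rfl⟩⟩
  | cons x u ihu =>
    obtain ⟨hx, hu'⟩ := List.forall_mem_cons.mp hu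
    induction v with
    | nil =>
      rw [hw.eq_def [], map_one, sh_one]
      exact ⟨Submodule.subset_span ⟨_, hu, rfl⟩, fun h =>
        Submodule.subset_span ⟨_, ⟨hu, h.elim id False.elim⟩, rfl⟩⟩
    | cons y v ihv =>
      obtain ⟨hy, hv'⟩ := List.forall_mem_cons.mp hv
      have hd {w : H} (h : w ∈ MD) (P : Prop) : w ∈ MB ∧ (P → w ∈ MD) :=
        ⟨MD_le_MB h, fun _ => h⟩
      rcases hx with rfl | rfl
      · rw [toH_hw_cons_d, mul_d_sh]
        exact hd (mul_d_mem_MD (ihu _ hu' hv).1) _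
      · rcases hy with rfl | rfl
        · rw [toH_hw_cons_d, sh_mul_d]
          exact hd (mul_d_mem_MD (ihv hv').1) _
        · have h1 := ihv hv'
          have h2 := ihu _ hu' hv
          have h3 := mul_d_mem_MD (ihu _ hu' hv').1
          rw [toH_hw_cons_g_one] at h1 h2
          rw [toH_hw_cons_g_one, toH_hw_cons_g_one, mul_g_one_sh_mul_g_one]
          exact ⟨mul_g_one_mem_MB (add_mem (add_mem h1.1 h2.1) (MD_le_MB h3)), fun h =>
            mul_g_one_mem_MD (add_mem (add_mem (h1.2 h) (h2.2 h)) h3)⟩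

theorem sh_mem_MD_left {x y : H} (hx : x ∈ MD) (hy : y ∈ MB) : sh x y ∈ MD := by
  have : MD ≤ (MD.comap (sh.flip y)) := by
    refine Submodule.span_le.mpr ?_
    rintro _ ⟨u, hu, rfl⟩
    have : MB ≤ MD.comap (sh (toH (hw u))) := by
      refine Submodule.span_le.mpr ?_
      rintro _ ⟨v, hv, rfl⟩
      exact (sh_word_mem u v hu.1 hv).2 (.inl hu.2)
    exact this hy
  exact this hx

theorem sh_mem_MD_right {x y : H} (hx : x ∈ MB) (hy : y ∈ MD) : sh x y ∈ MD := by
  have : MB ≤ (MD.comap (sh.flip y)) := by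
    refine Submodule.span_le.mpr ?_
    rintro _ ⟨u, hu, rfl⟩
    have : MD ≤ MD.comap (sh (toH (hw u))) := by
      refine Submodule.span_le.mpr ?_
      rintro _ ⟨v, hv, rfl⟩
      exact (sh_word_mem u v hu hv.1).2 (.inr hv.2)
    exact this hy
  exact this hx

/-- Without the collision term the recursion is Pascal's rule, as for the ordinary shuffle of powers
of one letter. -/
theorem sh_g_one_pow (i j : ℕ) :
    sh (g 1 ^ i) (g 1 ^ j) - (((i + j).choose i : ℕ) : Coef) • g 1 ^ (i + j) ∈ MD := by
  induction i generalizing j with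
  | zero => simp [one_sh]
  | succ i ihi =>
    induction j with
    | zero => simp [sh_one]
    | succ j ihj =>
      have hMB : sh (g 1 ^ i) (g 1 ^ j) ∈ MB := by
        have := add_mem (MD_le_MB (ihi j))
          (Submodule.smul_mem MB (((i + j).choose i : ℕ) : Coef) (g_one_pow_mem_MB (i + j)))
        rwa [sub_add_cancel] at this
      have h := mul_g_one_mem_MD (add_mem (add_mem ihj (ihi (j + 1))) (mul_d_mem_MD hMB))
      rw [pow_succ (g 1) i, pow_succ (g 1) j, mul_g_one_sh_mul_g_one, ← pow_succ, ← pow_succ]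
      convert h using 1
      have e1 : i + 1 + (j + 1) = i + j + 1 + 1 := by ring
      have e2 : i + 1 + j = i + j + 1 := by ring
      have e3 : i + (j + 1) = i + j + 1 := by ring
      rw [e1, e2, e3, Nat.choose_succ_succ, pow_succ _ (i + j + 1)]
      push_cast
      simp only [add_smul, add_mul, sub_mul, smul_mul_assoc]
      abel

theorem shPow_sub_mem_MD {w : H} (hw : w - g 1 ∈ MD) (n : ℕ) :
    shPow w n - ((n.factorial : ℕ) : Coef) • g 1 ^ n ∈ MD := by
  induction n with
  | zero => simp [shPow]
  | succ n ih =>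
    have hw' : w ∈ MB := by
      have := add_mem (MD_le_MB hw) (g_one_pow_mem_MB 1)
      rwa [pow_one, sub_add_cancel] at this
    have h1 := sh_mem_MD_right hw' ih
    have h2 := Submodule.smul_mem MD ((n.factorial : ℕ) : Coef)
      (add_mem (sh_mem_MD_left hw (g_one_pow_mem_MB n)) (sh_g_one_pow 1 n))
    convert add_mem h1 h2 using 1
    rw [shPow, pow_one, add_comm 1 n, Nat.choose_one_right, Nat.factorial_succ, mul_comm (n + 1)]
    push_cast
    simp only [map_sub, map_smul, LinearMap.sub_apply, smul_sub, smul_add, smul_smul]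
    abel

/-- Since e_1 - g_1 = ħb, each of the m+1 summands is congruent to j! (m-j)! C(m,j) g_1^m = m!
g_1^m, independently of j. The normalisation 1/(m+1)! then leaves g_1^m. -/
theorem E1_sub_mem_MD (m : ℕ) : E1 m - g 1 ^ m ∈ MD := by
  have hg : g 1 - g 1 ∈ MD := by rw [sub_self]; exact zero_mem _
  have hd : e 1 - g 1 ∈ MD := by
    have := mul_d_mem_MD one_mem_MB
    rwa [one_mul, ← e_one_sub_g_one] at this
  have key : ∀ j ∈ Finset.range (m + 1), sh (shPow (g 1) j) (shPow (e 1) (m - j)) -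
      ((m.factorial : ℕ) : Coef) • g 1 ^ m ∈ MD := by
    intro j hj
    have hjm : j ≤ m := Nat.lt_succ_iff.mp (Finset.mem_range.mp hj)
    have h1 := shPow_sub_mem_MD hg j
    have h2 := shPow_sub_mem_MD hd (m - j)
    have h2' : shPow (e 1) (m - j) ∈ MB := by
      have := add_mem (MD_le_MB h2) (Submodule.smul_mem MB (((m - j).factorial : ℕ) : Coef)
        (g_one_pow_mem_MB (m - j)))
      rwa [sub_add_cancel] at this
    have h3 := Submodule.smul_mem MD ((((m - j).factorial * j.factorial : ℕ) : ℕ) : Coef)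
      (sh_g_one_pow j (m - j))
    have h4 := Submodule.smul_mem MD ((j.factorial : ℕ) : Coef)
      (sh_mem_MD_right (g_one_pow_mem_MB j) h2)
    convert add_mem (add_mem (sh_mem_MD_left h1 h2') h4) h3 using 1
    have hc : (m - j).factorial * j.factorial * m.choose j = m.factorial := by
      rw [← Nat.choose_mul_factorial_mul_factorial hjm]; ring
    rw [Nat.add_sub_cancel' hjm]
    simp only [map_sub, map_smul, LinearMap.sub_apply, LinearMap.smul_apply, smul_sub, smul_smul,
      ← Nat.cast_mul, hc]
    rw [mul_comm j.factorial]
    abel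
  have h := Submodule.smul_mem MD (Polynomial.C (1 / ((m + 1).factorial : ℚ))) (sum_mem key)
  rw [Finset.sum_sub_distrib, Finset.sum_const, Finset.card_range, smul_sub,
    ← rat_smul_eq, ← rat_smul_eq] at h
  have hc : (1 / ((m + 1).factorial : ℚ)) • (m + 1) • ((m.factorial : ℕ) : Coef) • g 1 ^ m =
      g 1 ^ m := by
    rw [← Nat.cast_smul_eq_nsmul Coef, smul_smul, ← Nat.cast_mul, ← Nat.factorial_succ,
      rat_smul_eq, smul_smul]
    have h : (((m + 1).factorial : ℕ) : Coef) = Polynomial.C (((m + 1).factorial : ℕ) : ℚ) := by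
      simp
    rw [h, ← Polynomial.C_mul, one_div_mul_cancel
      (Nat.cast_ne_zero.mpr (Nat.factorial_ne_zero _)), map_one, one_smul]
  rw [hc] at h
  exact h

theorem E1_zero : E1 0 = 1 := by
  simp [E1, shPow, one_sh]

theorem exists_E1 (m : ℕ) : ∃ x : LA, toH x = E1 m ∧ x - li (.g 1) ^ m ∈ LD := by
  have : MD ≤ LD.map toH.toLinearMap := by
    refine Submodule.span_le.mpr ?_
    rintro _ ⟨u, hu, rfl⟩
    exact ⟨hw u, hw_mem_lspan hu.2, rfl⟩
  obtain ⟨x, hx, h⟩ := this (E1_sub_mem_MD m)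
  refine ⟨x + li (.g 1) ^ m, ?_, by rwa [add_sub_cancel_right]⟩
  rw [map_add, map_pow, toH_li_g, PNat.one_coe]
  exact eq_sub_iff_add_eq.mp h

/-! ### The elements `E_𝐤` -/

/-- `g_𝐤` in the free algebra on the letters. -/
def gA (l : Index) : LA := (l.map fun j : ℕ+ => li (.g j)).prod

theorem toH_gA (l : Index) : toH (gA l) = gIndex l := by
  rw [gA, map_list_prod, List.map_map, gIndex]
  congr 2
  ext1 j
  exact toH_li_g j

theorem gA_mem_LH (l : Index) : gA l ∈ LH := by
  induction l with
  | nil => exact one_mem_LH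
  | cons k l ih =>
    rw [gA, List.map_cons, List.prod_cons]
    exact mul_mem_LH (li_g_mem_LH k) ih

theorem e_eq (k : ℕ) (hk : 2 ≤ k) : e k = g k + (Polynomial.X : Coef) • g (k - 1) := by
  obtain ⟨k, rfl⟩ := Nat.exists_eq_add_of_le' hk
  rw [e, g, g, mul_add, add_mul, show k + 2 - 1 = k + 1 by omega, mul_assoc, ← pow_succ',
    hbar, ← Algebra.commutes, ← Algebra.smul_def, smul_mul_assoc]

/-- Replacing E_{1^s} by g_1^s costs words containing ħb, and e_k = g_k + ħ g_{k-1}. Since the last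
entry is at least 2, every run of ones is followed by a letter with k ≥ 2, which puts the first
error into `LN`; the second is a multiple of ħ. -/
theorem exists_EAux (s : ℕ) (l : Index) (hl : l ≠ []) (hl2 : 2 ≤ l.getLast hl) :
    ∃ x : LA, toH x = EAux s l ∧ x - li (.g 1) ^ s * gA l ∈ LN := by
  induction l generalizing s with
  | nil => exact absurd rfl hl
  | cons k l ih =>
    by_cases hk : k = 1
    · have hl' : l ≠ [] := by
        rintro rfl
        rw [List.getLast_singleton, hk] at hl2
        exact absurd hl2 (by decide)
      obtain ⟨x, hx, h⟩ := ih (s + 1) hl' (by rwa [List.getLast_cons hl'] at hl2)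
      refine ⟨x, by rw [hx, EAux, if_pos hk], ?_⟩
      rwa [pow_succ, mul_assoc, show li (.g 1) * gA l = gA (k :: l) by rw [hk]; rfl] at h
    · have hk2 : 2 ≤ k := by
        exact lt_of_le_of_ne (_root_.one_le : 1 ≤ k) (Ne.symm hk)
      have hk2' : 2 ≤ (k : ℕ) := hk2
      obtain ⟨x, hx, h⟩ := exists_E1 s
      let k' : ℕ+ := ⟨k - 1, by omega⟩
      have hy : toH (x * (li (.g k) + (Polynomial.X : Coef) • li (.g k'))) = E1 s * e k := by
        rw [map_mul, hx, map_add, map_smul, toH_li_g, toH_li_g, e_eq k hk2']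
        rfl
      have hyN : x * (li (.g k) + (Polynomial.X : Coef) • li (.g k')) -
          li (.g 1) ^ s * li (.g k) ∈ LN := by
        convert add_mem (mul_li_g_mem_LN h hk2) (X_smul_mem_LN (mul_li_g_mem_LH x k')) using 1
        rw [mul_add, sub_mul, mul_smul_comm]
        abel
      set y := x * (li (.g k) + (Polynomial.X : Coef) • li (.g k'))
      clear_value y
      by_cases hl' : l = []
      · subst hl'
        refine ⟨y, by rw [EAux, if_neg hk, hy, EAux, E1_zero, mul_one], ?_⟩
        rw [gA, List.map_cons, List.prod_cons]
        simpa using hyN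
      · obtain ⟨z, hz, hzN⟩ := ih 0 hl' (by rwa [List.getLast_cons hl'] at hl2)
        rw [pow_zero, one_mul] at hzN
        refine ⟨y * z, by rw [EAux, if_neg hk, map_mul, hy, hz], ?_⟩
        have hzH : z ∈ LH := by
          have := add_mem (LN_le_LH hzN) (gA_mem_LH l)
          rwa [sub_add_cancel] at this
        convert add_mem (mul_mem_LN_left hyN hzH)
          (mul_mem_LN_right (mul_li_g_mem_LH (li (.g 1) ^ s) k) hzN) using 1
        rw [gA, List.map_cons, List.prod_cons, ← gA, sub_mul, mul_sub, mul_assoc, mul_assoc]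
        abel

/-! ### Concatenation with `exp_sh(g_1 X)` compared with multiplication -/

theorem sum_antidiagonal_assoc {V : Type*} [AddCommMonoid V] (f : ℕ → ℕ → ℕ → V) (n : ℕ) :
    ∑ p ∈ antidiagonal n, ∑ r ∈ antidiagonal p.1, f r.1 r.2 p.2 =
      ∑ p ∈ antidiagonal n, ∑ r ∈ antidiagonal p.2, f p.1 r.1 r.2 := by
  rw [Finset.sum_sigma', Finset.sum_sigma']
  refine Finset.sum_bij' (fun x _ => ⟨(x.2.1, x.2.2 + x.1.2), (x.2.2, x.1.2)⟩)
    (fun x _ => ⟨(x.1.1 + x.2.1, x.2.2), (x.1.1, x.2.1)⟩) ?_ ?_ ?_ ?_ ?_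
  all_goals
    rintro ⟨⟨i, j⟩, ⟨k, l⟩⟩ h
    simp only [Finset.mem_sigma, Finset.HasAntidiagonal.mem_antidiagonal] at h ⊢
  · exact ⟨by omega, trivial⟩
  · exact ⟨by omega, trivial⟩
  · obtain ⟨h1, rfl⟩ := h; rfl
  · obtain ⟨h1, rfl⟩ := h; rfl

theorem sum_antidiagonal_left_comm {V : Type*} [AddCommMonoid V] (f : ℕ → ℕ → ℕ → V) (n : ℕ) :
    ∑ p ∈ antidiagonal n, ∑ r ∈ antidiagonal p.2, f p.1 r.1 r.2 =
      ∑ p ∈ antidiagonal n, ∑ r ∈ antidiagonal p.2, f r.1 p.1 r.2 := by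
  rw [← sum_antidiagonal_assoc, ← sum_antidiagonal_assoc (fun i j k => f j i k)]
  refine Finset.sum_congr rfl fun p _ => ?_
  exact (Finset.Nat.sum_antidiagonal_swap (f := fun r => f r.1 r.2 p.2)).symm

theorem sum_antidiagonal_sub_mem {V : Type*} [AddCommGroup V] [Module Coef V]
    (W : Submodule Coef V) (f : ℕ × ℕ → V) (h : ∀ i l, f (i + 1, l) ∈ W) (n : ℕ) :
    ∑ p ∈ antidiagonal n, f p - f (0, n) ∈ W := by
  cases n with
  | zero => simp
  | succ n =>
    rw [Finset.Nat.sum_antidiagonal_succ, add_sub_cancel_left]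
    exact sum_mem fun p _ => h _ _

theorem app_dA_zero (f : Seq q) : app (dA 0) f = f := by rw [dA_zero, app_one]

theorem app_dA_succ (n : ℕ) (f : Seq q) : app (dA (n + 1)) f =
    ∑ p ∈ antidiagonal n, cinv p.1 • step (.g 1) ((step .d ^ p.1) (app (dA p.2) f)) := by
  rw [dA_succ, app_sum]
  refine Finset.sum_congr rfl fun p _ => ?_
  rw [app_smul, app_mul, app_mul, app_pow, app_li, app_li]

/-- Concatenation of a series with `exp_sh(g_1 X)` on the right. -/
def concatD (y : ℕ → Seq q) (n : ℕ) : Seq q := ∑ p ∈ antidiagonal n, app (dA p.1) (y p.2)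

theorem concatD_zero (y : ℕ → Seq q) : concatD y 0 = y 0 := by
  simp [concatD, app_dA_zero]

/-- This is the recursion of `dseq` with `y` as inhomogeneous term; congruences with `concatD` are
proved by matching it. -/
theorem concatD_succ (y : ℕ → Seq q) (n : ℕ) : concatD y (n + 1) = y (n + 1) +
    ∑ p ∈ antidiagonal n, cinv p.1 • step (.g 1) ((step .d ^ p.1) (concatD y p.2)) := by
  rw [concatD, Finset.Nat.sum_antidiagonal_succ, app_dA_zero]
  congr 1
  simp only [app_dA_succ, concatD, map_sum, Finset.smul_sum]
  exact sum_antidiagonal_assoc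
    (fun i l j => cinv i • step (.g 1) ((step .d ^ i) (app (dA l) (y j)))) n

/-- The truncated sums of `g_1^n`. -/
def pseq (q : ℂ) : ℕ → Seq q
  | 0 => 1
  | n + 1 => step (.g 1) (pseq q n)

/-- The truncated sums of the coefficients of `exp_sh(g_1 X)`. -/
def dseq (q : ℂ) (n : ℕ) : Seq q := zl q (dA n)

theorem dseq_zero : dseq q 0 = 1 := app_dA_zero 1

theorem dseq_succ (n : ℕ) : dseq q (n + 1) =
    ∑ p ∈ antidiagonal n, cinv p.1 • step (.g 1) ((step .d ^ p.1) (dseq q p.2)) :=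
  app_dA_succ n 1

theorem dseq_mem_SH (n : ℕ) : dseq q n ∈ SH q := by
  rw [← map_LH]; exact ⟨_, dA_mem_LH n, rfl⟩

theorem dseq_mem_SA (n : ℕ) : dseq q n ∈ SA q := zl_mem_SA _

theorem pseq_mem_SH (n : ℕ) : pseq q n ∈ SH q := by
  induction n with
  | zero => exact one_mem_SH
  | succ n ih => exact step_g_mem_SH (SH_le_SA ih)

theorem step_pow_mem_SA {f : Seq q} (hf : f ∈ SA q) (i : ℕ) : (step .d ^ i) f ∈ SA q := by
  induction i with
  | zero => exact hf
  | succ i ih => rw [pow_succ']; exact step_mem_SA ih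

theorem step_pow_mem_SQ {f : Seq q} (hf : f ∈ SQ q) (i : ℕ) : (step .d ^ i) f ∈ SQ q := by
  induction i with
  | zero => exact hf
  | succ i ih => rw [pow_succ']; exact step_mem_SQ ih

theorem step_pow_succ_mem_SD {f : Seq q} (hf : f ∈ SA q) (i : ℕ) :
    (step .d ^ (i + 1)) f ∈ SD q := by
  rw [pow_succ']; exact step_d_mem_SD (step_pow_mem_SA hf i)

/-- Only the summand with i = 0 in the recursion of `dseq` appends no ħb, and that summand is the
recursion of `pseq`. -/
theorem dseq_sub_pseq_mem (n : ℕ) : dseq q n - pseq q n ∈ SD q := by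
  induction n with
  | zero => rw [dseq_zero, pseq, sub_self]; exact zero_mem _
  | succ n ih =>
    have h := sum_antidiagonal_sub_mem (SD q)
      (fun p => cinv p.1 • step (.g 1) ((step .d ^ p.1) (dseq q p.2)))
      (fun i l => Submodule.smul_mem _ _ (step_mem_SD (step_pow_succ_mem_SD (dseq_mem_SA l) i))) n
    convert add_mem h (step_mem_SD (x := .g 1) ih) using 1
    rw [dseq_succ, pseq, map_sub, cinv_zero, pow_zero, one_smul]
    exact (sub_add_sub_cancel _ _ _).symm

theorem sum_cinv_sub_pseq_mem (n : ℕ) :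
    ∑ p ∈ antidiagonal n, cinv p.1 • (step .d ^ p.1) (dseq q p.2) - pseq q n ∈ SD q := by
  have h := sum_antidiagonal_sub_mem (SD q)
    (fun p => cinv p.1 • (step .d ^ p.1) (dseq q p.2))
    (fun i l => Submodule.smul_mem _ _ (step_pow_succ_mem_SD (dseq_mem_SA l) i)) n
  convert add_mem h (dseq_sub_pseq_mem n) using 1
  rw [cinv_zero, pow_zero, one_smul]
  exact (sub_add_sub_cancel _ _ _).symm

/-! ### Multiplying truncated sums by `exp_sh(g_1 X)` -/

/-- Span of the summands whose last letter is some `g_k` with `k ≥ 2`. -/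
def J2 (q : ℂ) : Submodule Coef (Seq q) :=
  Submodule.span Coef {x | ∃ k : ℕ+, 2 ≤ k ∧ ∃ y ∈ SA q, x = Fseq q (.g k) * y}

theorem J2_le {W : Submodule Coef (Seq q)}
    (h : ∀ k : ℕ+, 2 ≤ k → ∀ y ∈ SA q, Fseq q (.g k) * y ∈ W) : J2 q ≤ W := by
  refine Submodule.span_le.mpr ?_
  rintro _ ⟨k, hk, y, hy, rfl⟩
  exact h k hk y hy

theorem Fseq_mul_mem_J2 {k : ℕ+} (hk : 2 ≤ k) {y : Seq q} (hy : y ∈ SA q) :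
    Fseq q (.g k) * y ∈ J2 q := Submodule.subset_span ⟨k, hk, y, hy, rfl⟩

theorem psum_mem_SH {x : Seq q} (hx : x ∈ J2 q) : psum x ∈ SH q := by
  have : J2 q ≤ (SH q).comap psum := J2_le fun k _ y hy => step_g_mem_SH hy
  exact this hx

theorem mul_mem_J2 {x y : Seq q} (hx : x ∈ J2 q) (hy : y ∈ SA q) : x * y ∈ J2 q := by
  have : J2 q ≤ (J2 q).comap (LinearMap.mulRight Coef y) := J2_le fun k hk z hz => by
    rw [Submodule.mem_comap, LinearMap.mulRight_apply, mul_assoc]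
    exact Fseq_mul_mem_J2 hk (mul_mem_SA hz hy)
  exact this hx

/-- The factor is a summand rather than a truncated sum, so `mul_mem_J2` is not the tool here: it
acts by raising the exponent of the last letter. -/
theorem mul_Fseq_mem_J2 {x : Seq q} (hx : x ∈ J2 q) : x * Fseq q (.g 1) ∈ J2 q := by
  have : J2 q ≤ (J2 q).comap (LinearMap.mulRight Coef (Fseq q (.g 1))) := J2_le fun k _ z hz => by
    rw [Submodule.mem_comap, LinearMap.mulRight_apply, mul_right_comm, Fseq_g_mul]
    exact Fseq_mul_mem_J2 (two_le_add k 1) hz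
  exact this hx

theorem psum_mul_mem_SN {x y : Seq q} (hx : x ∈ J2 q) (hy : y ∈ SD q) : psum (x * y) ∈ SN q := by
  have : J2 q ≤ (SN q).comap (psum.comp (LinearMap.mulRight Coef y)) := J2_le fun k hk z hz => by
    rw [Submodule.mem_comap, LinearMap.comp_apply, LinearMap.mulRight_apply, mul_assoc]
    exact step_g_mem_SN_of_two_le hk (by rw [mul_comm]; exact mul_mem_SD hy hz)
  exact this hx

theorem psum_mul_step (x f : Seq q) (u : Letter) : psum x * step u f =
    psum (x * step u f) + step u (psum x * f) + psum (x * Fseq q u * f) := by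
  simp only [step_apply]
  rw [psum_mul_psum, mul_assoc, mul_left_comm]

/-- Moving `psum x` past an appended ħb leaves two errors. In one, the letter g_k (k ≥ 2) of `x`
comes after ħb; in the other it collides with ħb and yields a factor ħ. -/
theorem psum_mul_step_pow_sub_mem {x : Seq q} (hx : x ∈ J2 q) {f : Seq q} (hf : f ∈ SA q)
    (i : ℕ) : psum x * (step .d ^ i) f - (step .d ^ i) (psum x * f) ∈ SQ q := by
  induction i with
  | zero => rw [pow_zero]; exact (sub_self (psum x * f)) ▸ zero_mem _
  | succ i ih =>
    have hy := step_pow_mem_SA hf i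
    set y := (step .d ^ i) f
    have h1 : psum (x * step .d y) ∈ SQ q := SN_le_SQ (psum_mul_mem_SN hx (step_d_mem_SD hy))
    have h2 : psum (x * Fseq q .d * y) ∈ SQ q := by
      rw [Fseq_d, mul_assoc, mul_left_comm, ← Algebra.smul_def, map_smul]
      exact X_smul_mem_SQ (SH_le_SA (psum_mem_SH (mul_mem_J2 hx hy)))
    convert add_mem (add_mem h1 (step_mem_SQ (x := .d) ih)) h2 using 1
    rw [pow_succ', Module.End.mul_apply, Module.End.mul_apply, psum_mul_step, map_sub]
    abel

/-- The coefficients of `∏_{j ≤ m} (1 + F(j; g_1) X)`. -/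
def useq (q : ℂ) : ℕ → Seq q
  | 0 => 1
  | n + 1 => pseq q (n + 1) + Fseq q (.g 1) * pseq q n

/-- Expand `psum x * dseq q (n + 1)` by the product rule. Where g_1 comes last, `psum x` moves past
the letters ħb and the induction hypothesis applies. Where the letter of `x` comes last or collides
with g_1, it has exponent at least 2, so words with an earlier ħb may be dropped; what remains is
`psum (x * useq q (n + 1))`, the inhomogeneous term of `concatD_succ`. -/
theorem psum_mul_dseq_sub_mem {x : Seq q} (hx : x ∈ J2 q) (n : ℕ) :
    psum x * dseq q n - concatD (fun j => psum (x * useq q j)) n ∈ SN q := by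
  induction n using Nat.strong_induction_on with
  | _ n ih =>
    cases n with
    | zero =>
      rw [concatD_zero, dseq_zero, useq, mul_one, mul_one, sub_self]; exact zero_mem _
    | succ n =>
      have h1 : ∑ p ∈ antidiagonal n, cinv p.1 • step (.g 1)
          (psum x * (step .d ^ p.1) (dseq q p.2) - (step .d ^ p.1) (psum x * dseq q p.2)) ∈
            SN q :=
        sum_mem fun p _ => Submodule.smul_mem _ _
          (step_g_mem_SN (psum_mul_step_pow_sub_mem hx (dseq_mem_SA _) _))
      -- Here and in `h3`, D is replaced by P: the pieces `pseq q (n + 1)` and `Fseq q (.g 1) * pseq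
      -- q n` add up to `useq q (n + 1)`.
      have h2 := psum_mul_mem_SN hx (dseq_sub_pseq_mem (n + 1))
      have h3 := psum_mul_mem_SN (mul_Fseq_mem_J2 hx) (sum_cinv_sub_pseq_mem n)
      have h4 : ∑ p ∈ antidiagonal n, cinv p.1 • step (.g 1) ((step .d ^ p.1)
          (psum x * dseq q p.2 - concatD (fun j => psum (x * useq q j)) p.2)) ∈ SN q := by
        refine sum_mem fun p hp => Submodule.smul_mem _ _
          (step_g_mem_SN (step_pow_mem_SQ (SN_le_SQ (ih _ ?_)) _))
        have := Finset.HasAntidiagonal.mem_antidiagonal.mp hp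
        omega
      convert add_mem (add_mem (add_mem h1 h2) h3) h4 using 1
      have e1 : psum x * dseq q (n + 1) =
          ∑ p ∈ antidiagonal n, cinv p.1 •
            step (.g 1) (psum x * (step .d ^ p.1) (dseq q p.2)) +
          psum (x * dseq q (n + 1)) +
          psum (x * Fseq q (.g 1) *
            ∑ p ∈ antidiagonal n, cinv p.1 • (step .d ^ p.1) (dseq q p.2)) := by
        rw [dseq_succ]
        simp only [Finset.mul_sum, map_sum, ← Finset.sum_add_distrib, mul_smul_comm, map_smul,
          ← smul_add]
        refine Finset.sum_congr rfl fun p _ => ?_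
        rw [psum_mul_step]
        congr 1
        abel
      rw [e1, concatD_succ, useq]
      simp only [map_sub, smul_sub, Finset.sum_sub_distrib, mul_sub, mul_add, map_add, mul_assoc]
      abel

theorem coeff_mem_of_mul_eq {R : Type*} [CommRing R] (S : Subring R) {f u p : PowerSeries R}
    (h : f * u = p) (hu0 : PowerSeries.constantCoeff u = 1)
    (hu : ∀ n, PowerSeries.coeff n u ∈ S) (hp : ∀ n, PowerSeries.coeff n p ∈ S) (n : ℕ) :
    PowerSeries.coeff n f ∈ S := by
  induction n using Nat.strong_induction_on with
  | _ n ih =>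
    have h1 := congrArg (PowerSeries.coeff n) h
    rw [PowerSeries.coeff_mul] at h1
    cases n with
    | zero =>
      simp only [Finset.Nat.antidiagonal_zero, Finset.sum_singleton,
        PowerSeries.coeff_zero_eq_constantCoeff, hu0, mul_one] at h1
      rw [PowerSeries.coeff_zero_eq_constantCoeff, h1, ← PowerSeries.coeff_zero_eq_constantCoeff]
      exact hp 0
    | succ n =>
      rw [Finset.Nat.sum_antidiagonal_succ', PowerSeries.coeff_zero_eq_constantCoeff, hu0,
        mul_one] at h1
      rw [eq_sub_of_add_eq h1]
      refine S.sub_mem (hp _) (S.sum_mem fun p hp => S.mul_mem (ih _ ?_) (hu _))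
      have := Finset.HasAntidiagonal.mem_antidiagonal.mp hp
      omega

/-! ### Dividing by `∏ (1 + F(j; g_1) X)` -/

/-- The multipliers of `J2`. -/
def mulJ2 (q : ℂ) : Subring (Seq q) where
  carrier := {y | ∀ x ∈ J2 q, x * y ∈ J2 q}
  mul_mem' hy hz x hx := by rw [← mul_assoc]; exact hz _ (hy _ hx)
  one_mem' x hx := by rwa [mul_one]
  add_mem' hy hz x hx := by rw [mul_add]; exact add_mem (hy _ hx) (hz _ hx)
  zero_mem' x _ := by rw [mul_zero]; exact zero_mem _
  neg_mem' hy x hx := by rw [mul_neg]; exact neg_mem (hy _ hx)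

theorem useq_mem_mulJ2 (n : ℕ) : useq q n ∈ mulJ2 q := by
  have hp (n : ℕ) : pseq q n ∈ mulJ2 q := fun x hx => mul_mem_J2 hx (SH_le_SA (pseq_mem_SH n))
  cases n with
  | zero => exact one_mem _
  | succ n => exact add_mem (hp _) (mul_mem (fun x hx => mul_Fseq_mem_J2 hx) (hp n))

/-- The inverse of the series of `useq`. -/
def uinv (q : ℂ) : PowerSeries (Seq q) := PowerSeries.invOfUnit (PowerSeries.mk (useq q)) 1

theorem uinv_mul : uinv q * PowerSeries.mk (useq q) = 1 := by
  rw [mul_comm]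
  exact PowerSeries.mul_invOfUnit _ _ (by simp [useq])

/-- Inverting a series with constant term 1 uses only ring operations on its coefficients, and these
act on `J2`. -/
theorem coeff_uinv_mem (n : ℕ) : PowerSeries.coeff n (uinv q) ∈ mulJ2 q := by
  refine coeff_mem_of_mul_eq (mulJ2 q) uinv_mul (by simp [useq])
    (fun n => by rw [PowerSeries.coeff_mk]; exact useq_mem_mulJ2 n) (fun n => ?_) n
  rw [PowerSeries.coeff_one]
  split_ifs
  exacts [one_mem _, zero_mem _]

/-- The coefficients of `x ∏_{j ≤ m} (1 + F(j; g_1) X)⁻¹`. -/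
def xseq (x : Seq q) (n : ℕ) : Seq q := x * PowerSeries.coeff n (uinv q)

theorem xseq_mem {x : Seq q} (hx : x ∈ J2 q) (n : ℕ) : xseq x n ∈ J2 q := coeff_uinv_mem n x hx

theorem sum_xseq_mul_useq (x : Seq q) (n : ℕ) :
    ∑ p ∈ antidiagonal n, xseq x p.1 * useq q p.2 = if n = 0 then x else 0 := by
  have h := congrArg (fun f => x * PowerSeries.coeff n f) (uinv_mul (q := q))
  simp only [PowerSeries.coeff_mul, PowerSeries.coeff_mk, PowerSeries.coeff_one, Finset.mul_sum,
    mul_ite, mul_one, mul_zero] at h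
  rw [← h]
  exact Finset.sum_congr rfl fun p _ => mul_assoc _ _ _

/-- At each m, the inverse product over j ≤ m cancels those factors of ∏_{j<M}(1+F_q(j;g_1)X),
leaving the product over m < j < M, which appends powers of g_1. -/
theorem sum_psum_xseq_mul_pseq (x : Seq q) (n : ℕ) :
    ∑ p ∈ antidiagonal n, psum (xseq x p.1) * pseq q p.2 = (step (.g 1) ^ n) (psum x) := by
  induction n with
  | zero =>
    have h := sum_xseq_mul_useq x 0
    simp only [Finset.Nat.antidiagonal_zero, Finset.sum_singleton, useq, mul_one, if_true] at h
    simp [pseq, h]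
  | succ n ih =>
    have h := sum_xseq_mul_useq x (n + 1)
    rw [Finset.Nat.sum_antidiagonal_succ', if_neg (Nat.succ_ne_zero n)] at h
    rw [Finset.Nat.sum_antidiagonal_succ', pow_succ', Module.End.mul_apply, ← ih, map_sum]
    -- The terms in which the letter of `x` comes last or collides with g_1 add up to the
    -- coefficient of X^(n+1) in x U⁻¹ U, with U the series of `useq`, hence vanish.
    have h' := congrArg psum h
    rw [map_add, map_sum, map_zero] at h'
    simp only [useq, mul_one, mul_add, map_add, Finset.sum_add_distrib, ← mul_assoc] at h'
    simp only [pseq, psum_mul_step, mul_one, Finset.sum_add_distrib] at h' ⊢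
    linear_combination h'

/-- Apply `psum_mul_dseq_sub_mem` to each coefficient of x U⁻¹, with U the series of `useq`; the
convolution with `useq` then collapses to `x`. -/
theorem sum_psum_xseq_mul_dseq_sub_mem {x : Seq q} (hx : x ∈ J2 q) (n : ℕ) :
    ∑ p ∈ antidiagonal n, psum (xseq x p.1) * dseq q p.2 - app (dA n) (psum x) ∈ SN q := by
  have h : ∑ p ∈ antidiagonal n, (psum (xseq x p.1) * dseq q p.2 -
      concatD (fun j => psum (xseq x p.1 * useq q j)) p.2) ∈ SN q :=
    sum_mem fun p _ => psum_mul_dseq_sub_mem (xseq_mem hx _) _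
  rw [Finset.sum_sub_distrib] at h
  convert h using 2
  simp only [concatD]
  rw [sum_antidiagonal_left_comm (fun i l j => app (dA l) (psum (xseq x i * useq q j)))]
  simp only [← map_sum, sum_xseq_mul_useq]
  rw [Finset.sum_eq_single (n, 0)]
  · simp
  · rintro ⟨i, j⟩ hp hne
    have hj : j ≠ 0 := by
      rintro rfl
      simp_all
    simp [hj]
  · simp

theorem app_dA_mem_SN {x : Seq q} (hx : x ∈ SN q) (n : ℕ) : app (dA n) x ∈ SN q := by
  induction n using Nat.strong_induction_on with
  | _ n ih =>
    cases n with
    | zero => rwa [app_dA_zero]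
    | succ n =>
      rw [app_dA_succ]
      refine sum_mem fun p hp => Submodule.smul_mem _ _
          (step_g_mem_SN (step_pow_mem_SQ (SN_le_SQ (ih _ ?_)) _))
      have := Finset.HasAntidiagonal.mem_antidiagonal.mp hp
      omega

/-! ### Convergence -/

theorem norm_F_g_le (hq1 : ‖q‖ < 1) (m : ℕ) (k : ℕ+) :
    ‖F q (m + 1) (.g k)‖ ≤ (‖1 - q‖ / (1 - ‖q‖)) ^ (k : ℕ) * ‖q‖ ^ (m + 1) := by
  have h0 : 0 < 1 - ‖q‖ := sub_pos.mpr hq1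
  have h1 : 1 - ‖q‖ ≤ ‖1 - q ^ (m + 1)‖ := by
    have h2 : ‖q ^ (m + 1)‖ ≤ ‖q‖ := by
      rw [norm_pow]
      exact pow_le_of_le_one (norm_nonneg _) hq1.le (Nat.succ_ne_zero m)
    have h3 := norm_sub_norm_le (1 : ℂ) (q ^ (m + 1))
    rw [norm_one] at h3
    linarith
  have h2 : ‖q ^ ((k : ℕ) * (m + 1))‖ ≤ ‖q‖ ^ (m + 1) := by
    rw [norm_pow]
    exact pow_le_pow_of_le_one (norm_nonneg _) hq1.le (Nat.le_mul_of_pos_left _ k.2)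
  have h3 : ‖(qInt q (m + 1) ^ (k : ℕ))⁻¹‖ ≤ (‖1 - q‖ / (1 - ‖q‖)) ^ (k : ℕ) := by
    rw [← inv_pow, norm_pow, qInt, inv_div, norm_div]
    gcongr
  rw [F, div_eq_mul_inv, norm_mul, mul_comm]
  gcongr

theorem exists_norm_F_le (hq1 : ‖q‖ < 1) (u : Letter) :
    ∃ C : ℝ, 0 ≤ C ∧ ∀ m : ℕ, ‖F q (m + 1) u‖ ≤ C := by
  cases u with
  | d => exact ⟨‖1 - q‖, norm_nonneg _, fun m => le_rfl⟩
  | g k =>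
    have h0 : 0 < 1 - ‖q‖ := sub_pos.mpr hq1
    refine ⟨(‖1 - q‖ / (1 - ‖q‖)) ^ (k : ℕ), by positivity, fun m => ?_⟩
    refine (norm_F_g_le hq1 m k).trans (mul_le_of_le_one_right (by positivity) ?_)
    exact pow_le_one₀ (norm_nonneg _) hq1.le

theorem norm_step_le {x : Letter} {f : Seq q} {N : ℕ} :
    ‖step x f N‖ ≤ ∑ n ∈ Finset.range N, ‖F q (n + 1) x‖ * ‖f n‖ := by
  rw [step_apply, psum_apply]
  refine (norm_sum_le _ _).trans (Finset.sum_le_sum fun n _ => ?_)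
  rw [Seq.mul_apply, norm_mul]
  rfl

/-- Polynomial growth is enough for convergence, since a final g_k contributes geometric decay. -/
theorem exists_norm_wseq_le (hq1 : ‖q‖ < 1) (u : List Letter) :
    ∃ C : ℝ, 0 ≤ C ∧ ∀ N : ℕ, ‖wseq q u N‖ ≤ C * ((N : ℝ) + 1) ^ u.length := by
  induction u with
  | nil =>
    refine ⟨1, zero_le_one, fun N => ?_⟩
    rw [wseq, Seq.one_apply]
    simp
  | cons x u ih =>
    obtain ⟨C, hC, h⟩ := ih
    obtain ⟨K, hK, hF⟩ := exists_norm_F_le hq1 x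
    refine ⟨K * C, mul_nonneg hK hC, fun N => norm_step_le.trans ?_⟩
    have : ∀ n ∈ Finset.range N, ‖F q (n + 1) x‖ * ‖wseq q u n‖ ≤
        K * (C * ((N : ℝ) + 1) ^ u.length) := fun n hn => by
      have hn : (n : ℝ) ≤ N := Nat.cast_le.mpr (Finset.mem_range.mp hn).le
      refine mul_le_mul (hF n) ((h n).trans ?_) (norm_nonneg _) hK
      gcongr
    refine (Finset.sum_le_sum this).trans ?_
    rw [Finset.sum_const, Finset.card_range, nsmul_eq_mul, List.length_cons, pow_succ]
    have : 0 ≤ K * C * ((N : ℝ) + 1) ^ u.length := by positivity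
    nlinarith

theorem summable_Fseq_mul_wseq (hq1 : ‖q‖ < 1) (k : ℕ+) (u : List Letter) :
    Summable fun n => ‖(Fseq q (.g k) * wseq q u) n‖ := by
  obtain ⟨C, hC, h⟩ := exists_norm_wseq_le hq1 u
  have h0 : 0 < 1 - ‖q‖ := sub_pos.mpr hq1
  have hs := summable_pow_mul_geometric_of_norm_lt_one u.length (r := ‖q‖) (by simpa using hq1)
  rw [← summable_nat_add_iff 1] at hs
  refine Summable.of_nonneg_of_le (fun n => norm_nonneg _) (fun n => ?_)
    (hs.mul_left ((‖1 - q‖ / (1 - ‖q‖)) ^ (k : ℕ) * C))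
  rw [Seq.mul_apply, norm_mul]
  refine (mul_le_mul (norm_F_g_le hq1 n k) (h n) (norm_nonneg _) (by positivity)).trans_eq ?_
  push_cast
  ring

/-- The sequence converges to `z`. -/
def Seq.TendsTo (x : Seq q) (z : ℂ) : Prop := Tendsto (fun N => x N) atTop (𝓝 z)

theorem Seq.TendsTo.add {x y : Seq q} {z w : ℂ} (hx : x.TendsTo z) (hy : y.TendsTo w) :
    (x + y).TendsTo (z + w) := Tendsto.add hx hy

theorem Seq.TendsTo.sub {x y : Seq q} {z w : ℂ} (hx : x.TendsTo z) (hy : y.TendsTo w) :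
    (x - y).TendsTo (z - w) := Tendsto.sub hx hy

theorem Seq.TendsTo.mul {x y : Seq q} {z w : ℂ} (hx : x.TendsTo z) (hy : y.TendsTo w) :
    (x * y).TendsTo (z * w) := Tendsto.mul hx hy

theorem Seq.TendsTo.sum {ι : Type*} {s : Finset ι} {x : ι → Seq q} {z : ι → ℂ}
    (h : ∀ i, (x i).TendsTo (z i)) : (∑ i ∈ s, x i).TendsTo (∑ i ∈ s, z i) := by
  have := tendsto_finsetSum s fun i _ => h i
  refine this.congr fun N => ?_
  exact (Seq.sum_apply s x N).symm

theorem Seq.tendsTo_zero : (0 : Seq q).TendsTo 0 := tendsto_const_nhds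

theorem Seq.tendsTo_one : (1 : Seq q).TendsTo 1 := tendsto_const_nhds

theorem Seq.TendsTo.smul {x : Seq q} {z : ℂ} (c : Coef) (hx : x.TendsTo z) :
    (c • x).TendsTo (evalCoef q c * z) := by
  refine (Tendsto.const_mul (evalCoef q c) hx).congr fun N => ?_
  exact (Seq.smul_apply c x N).symm

theorem Seq.TendsTo.unique {x : Seq q} {z w : ℂ} (hx : x.TendsTo z) (hy : x.TendsTo w) :
    z = w := tendsto_nhds_unique hx hy

/-- The convergent sequences. -/
def convergent (q : ℂ) : Submodule Coef (Seq q) where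
  carrier := {x | ∃ z, x.TendsTo z}
  zero_mem' := ⟨0, Seq.tendsTo_zero⟩
  add_mem' := fun ⟨_, hx⟩ ⟨_, hy⟩ => ⟨_, hx.add hy⟩
  smul_mem' := fun c _ ⟨_, hx⟩ => ⟨_, hx.smul c⟩

theorem SH_le_convergent (hq1 : ‖q‖ < 1) : SH q ≤ convergent q := by
  refine wspan_le (fun u hu => ?_) (fun _ h => h.elim)
  cases u with
  | nil => exact ⟨1, Seq.tendsTo_one⟩
  | cons x u =>
    cases x with
    | d => exact hu.elim
    | g k => exact ⟨_, (summable_Fseq_mul_wseq hq1 k u).of_norm.hasSum.tendsto_sum_nat⟩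

theorem tendsto_ZM_iff (x : LA) (z : ℂ) :
    Tendsto (fun M : ℕ => ZM q M (toH x)) atTop (𝓝 z) ↔ (zl q x).TendsTo z := by
  rw [← tendsto_add_atTop_iff_nat 1]
  simp only [ZM_toH]
  rfl

theorem Z_toH_of_tendsTo {x : LA} {z : ℂ} (h : (zl q x).TendsTo z) : Z q (toH x) = z :=
  ((tendsto_ZM_iff x z).mpr h).limUnder_eq

theorem tendsTo_Z {x : LA} (hq1 : ‖q‖ < 1) (hx : x ∈ LH) : (zl q x).TendsTo (Z q (toH x)) := by
  have h : zl q x ∈ SH q := by rw [← map_LH]; exact ⟨x, hx, rfl⟩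
  obtain ⟨z, hz⟩ := SH_le_convergent hq1 h
  rwa [Z_toH_of_tendsTo hz]

theorem mem_ZHat_of_tendsTo {x : Seq q} (hx : x ∈ SH q) {z : ℂ} (h : x.TendsTo z) :
    z ∈ ZHat q := by
  rw [← map_LH] at hx
  obtain ⟨y, hy, rfl⟩ := hx
  exact ⟨toH y, toH_mem_HHat hy, Z_toH_of_tendsTo h⟩

theorem mem_NN_of_tendsTo {x : Seq q} (hx : x ∈ SN q) {z : ℂ} (h : x.TendsTo z) : z ∈ NN q := by
  rw [← map_LN] at hx
  obtain ⟨y, hy, rfl⟩ := hx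
  exact ⟨toH y, toH_mem_nn hy, Z_toH_of_tendsTo h⟩

/-! ### The limit of `exp_sh(g_1 X)` -/

/-- `∑ q^m / [m] t^m`. -/
def Lser (q : ℂ) : PowerSeries ℂ := PowerSeries.mk fun m => q ^ m / qInt q m

/-- `t / (1 - t)`. -/
def tau : PowerSeries ℂ := PowerSeries.X * PowerSeries.mk fun _ => 1

/-- The equation L(t) - L(qt) = (1-q) qt/(1-qt) clears the denominators 1-q^m of L. -/
theorem Lser_eq (hq1 : ‖q‖ < 1) :
    Lser q = PowerSeries.C (1 - q) * PowerSeries.rescale q tau + PowerSeries.rescale q (Lser q) := by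
  ext m
  cases m with
  | zero =>
    -- Since `qInt q 0 = 0`, the constant term of `Lser` is a division by zero and has the value 0.
    simp only [map_add, PowerSeries.coeff_C_mul, PowerSeries.coeff_rescale, tau, Lser,
      PowerSeries.coeff_zero_X_mul, PowerSeries.coeff_mk, qInt]
    simp
  | succ m =>
    have h1 : 1 - q ^ (m + 1) ≠ 0 := by
      intro h
      have h2 : ‖q ^ (m + 1)‖ = 1 := by rw [← sub_eq_zero.mp h, norm_one]
      rw [norm_pow] at h2
      exact (pow_lt_one₀ (norm_nonneg q) hq1 (Nat.succ_ne_zero m)).ne h2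
    simp only [map_add, PowerSeries.coeff_C_mul, PowerSeries.coeff_rescale, tau, Lser,
      PowerSeries.coeff_succ_X_mul, PowerSeries.coeff_mk, qInt]
    rw [div_div_eq_mul_div]
    field_simp
    ring

/-- The coefficient sequence of `f / (1 - t)`. -/
def cum (q : ℂ) (f : PowerSeries ℂ) : Seq q :=
  fun N => ∑ j ∈ Finset.range (N + 1), PowerSeries.coeff j f

theorem cum_apply (f : PowerSeries ℂ) (N : ℕ) :
    cum q f N = ∑ j ∈ Finset.range (N + 1), PowerSeries.coeff j f := rfl

theorem coeff_succ_tau_mul (f : PowerSeries ℂ) (n : ℕ) :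
    PowerSeries.coeff (n + 1) (tau * f) = cum q f n := by
  rw [tau, mul_assoc, PowerSeries.coeff_succ_X_mul, mul_comm, PowerSeries.coeff_mul]
  simp only [PowerSeries.coeff_mk, mul_one]
  exact Finset.Nat.sum_antidiagonal_eq_sum_range_succ (fun i _ => PowerSeries.coeff i f) n

theorem coeff_zero_tau_mul (f : PowerSeries ℂ) : PowerSeries.coeff 0 (tau * f) = 0 := by
  simp [tau]

/-- On generating functions, appending a letter multiplies by t/(1-t) and weights the coefficient of
t^m by F_q(m; x). -/
theorem step_cum (x : Letter) (f : PowerSeries ℂ) (N : ℕ) : step x (cum q f) N =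
    ∑ n ∈ Finset.range N, F q (n + 1) x * PowerSeries.coeff (n + 1) (tau * f) := by
  rw [step_apply, psum_apply]
  refine Finset.sum_congr rfl fun n _ => ?_
  rw [Seq.mul_apply, coeff_succ_tau_mul]
  rfl

theorem step_d_cum (f : PowerSeries ℂ) :
    step .d (cum q f) = cum q (PowerSeries.C (1 - q) * tau * f) := by
  ext N
  rw [step_cum, cum_apply, Finset.sum_range_succ', mul_assoc, PowerSeries.coeff_C_mul,
    coeff_zero_tau_mul, mul_zero, add_zero]
  simp only [PowerSeries.coeff_C_mul, F]

theorem step_d_pow_cum (i : ℕ) (f : PowerSeries ℂ) :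
    (step .d ^ i) (cum q f) = cum q ((PowerSeries.C (1 - q) * tau) ^ i * f) := by
  induction i with
  | zero => simp
  | succ i ih => rw [pow_succ', Module.End.mul_apply, ih, step_d_cum, ← mul_assoc, ← pow_succ']

/-- `L(t)^n / n!`. -/
def vser (q : ℂ) (n : ℕ) : PowerSeries ℂ := PowerSeries.C ((n.factorial : ℂ)⁻¹) * Lser q ^ n

theorem vser_zero : vser q 0 = 1 := by simp [vser]

theorem evalCoef_cinv (i : ℕ) : evalCoef q (cinv i) = ((i + 1).factorial : ℂ)⁻¹ := by
  rw [cinv, evalCoef_C]; simp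

theorem rescale_C (c : ℂ) :
    PowerSeries.rescale q (PowerSeries.C c) = PowerSeries.C c := by
  ext n
  rw [PowerSeries.coeff_rescale, PowerSeries.coeff_C]
  by_cases h : n = 0 <;> simp [h]

/-- The binomial theorem for the two summands of `Lser_eq`. It produces the same factors 1/(i+1)! as
the recursion for exp_sh(g_1X). -/
theorem vser_succ (hq1 : ‖q‖ < 1) (n : ℕ) : vser q (n + 1) = PowerSeries.rescale q (vser q (n + 1)) +
    PowerSeries.rescale q (∑ p ∈ antidiagonal n, PowerSeries.C (evalCoef q (cinv p.1)) *
      (PowerSeries.C (1 - q) * tau) ^ (p.1 + 1) * vser q p.2) := by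
  have h : vser q (n + 1) = PowerSeries.rescale q (∑ p ∈ antidiagonal (n + 1),
      PowerSeries.C ((p.1.factorial : ℂ)⁻¹) *
      (PowerSeries.C (1 - q) * tau) ^ p.1 * vser q p.2) := by
    rw [map_sum, vser]
    conv_lhs => rw [Lser_eq hq1, (Commute.all _ _).add_pow', Finset.mul_sum]
    refine Finset.sum_congr rfl fun p hp => ?_
    have hp' := Finset.HasAntidiagonal.mem_antidiagonal.mp hp
    have h1 : ((n + 1).factorial : ℂ)⁻¹ * ((n + 1).choose p.1 : ℂ) =
        (p.1.factorial : ℂ)⁻¹ * (p.2.factorial : ℂ)⁻¹ := by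
      have h2 := congrArg (Nat.cast (R := ℂ))
        (Nat.choose_mul_factorial_mul_factorial (Nat.le_add_right p.1 p.2))
      rw [Nat.add_sub_cancel_left] at h2
      push_cast at h2
      have h3 := Nat.cast_ne_zero (R := ℂ).mpr (Nat.factorial_ne_zero (p.1 + p.2))
      have h4 := Nat.cast_ne_zero (R := ℂ).mpr (Nat.factorial_ne_zero p.1)
      have h5 := Nat.cast_ne_zero (R := ℂ).mpr (Nat.factorial_ne_zero p.2)
      rw [← hp']
      field_simp
      linear_combination h2
    have h2 := congrArg (PowerSeries.C (R := ℂ)) h1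
    rw [map_mul, map_mul, map_natCast] at h2
    rw [nsmul_eq_mul, ← mul_assoc, h2]
    simp only [vser, map_mul, map_pow, rescale_C]
    ring
  refine h.trans ?_
  rw [Finset.Nat.sum_antidiagonal_succ, map_add]
  simp only [evalCoef_cinv]
  congr 1
  simp

/-- An equation h(t) - h(qt) = (1-q) w(qt) gives h_m = (1-q) q^m/(1-q^m) w_m = F_q(m; g_1) w_m, so
solving it amounts to appending g_1. -/
theorem coeff_vser_succ (hq1 : ‖q‖ < 1) (n m : ℕ) : PowerSeries.coeff (m + 1) (vser q (n + 1)) =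
    ∑ p ∈ antidiagonal n, evalCoef q (cinv p.1) * (F q (m + 1) (.g 1) *
      PowerSeries.coeff (m + 1) (tau * ((PowerSeries.C (1 - q) * tau) ^ p.1 * vser q p.2))) := by
  have h := congrArg (PowerSeries.coeff (m + 1)) (vser_succ hq1 n)
  have h1 : 1 - q ^ (m + 1) ≠ 0 := by
    intro h
    have h2 : ‖q ^ (m + 1)‖ = 1 := by rw [← sub_eq_zero.mp h, norm_one]
    rw [norm_pow] at h2
    exact (pow_lt_one₀ (norm_nonneg q) hq1 (Nat.succ_ne_zero m)).ne h2
  have h3 : ∀ p : ℕ × ℕ, PowerSeries.C (evalCoef q (cinv p.1)) *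
      (PowerSeries.C (1 - q) * tau) ^ (p.1 + 1) * vser q p.2 =
      PowerSeries.C (1 - q) * (PowerSeries.C (evalCoef q (cinv p.1)) *
        (tau * ((PowerSeries.C (1 - q) * tau) ^ p.1 * vser q p.2))) := fun p => by ring
  simp only [h3, ← Finset.mul_sum] at h
  rw [map_add, PowerSeries.coeff_rescale, PowerSeries.coeff_rescale, PowerSeries.coeff_C_mul,
    map_sum] at h
  simp only [PowerSeries.coeff_C_mul] at h
  simp only [F, PNat.one_coe, one_mul, pow_one, qInt]
  simp only [mul_left_comm _ (q ^ (m + 1) / _), ← Finset.mul_sum]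
  rw [div_div_eq_mul_div, div_mul_eq_mul_div, eq_div_iff h1]
  linear_combination h

theorem dseq_eq_cum (hq1 : ‖q‖ < 1) (n : ℕ) : dseq q n = cum q (vser q n) := by
  induction n using Nat.strong_induction_on with
  | _ n ih =>
    cases n with
    | zero =>
      ext N
      rw [dseq_zero, vser_zero, cum_apply, Finset.sum_range_succ', Seq.one_apply]
      simp [PowerSeries.coeff_one]
    | succ n =>
      ext N
      rw [dseq_succ, Seq.sum_apply, cum_apply, Finset.sum_range_succ']
      have h0 : PowerSeries.coeff 0 (vser q (n + 1)) = 0 := by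
        simp [vser, Lser, qInt]
      rw [h0, add_zero]
      simp only [coeff_vser_succ hq1]
      rw [Finset.sum_comm]
      refine Finset.sum_congr rfl fun p hp => ?_
      have hp' := Finset.HasAntidiagonal.mem_antidiagonal.mp hp
      rw [Seq.smul_apply, ih p.2 (by omega), step_d_pow_cum, step_cum, Finset.mul_sum]

theorem summable_Lser (hq1 : ‖q‖ < 1) : Summable fun m => ‖PowerSeries.coeff m (Lser q)‖ := by
  rw [← summable_nat_add_iff 1]
  refine (summable_Fseq_mul_wseq hq1 1 []).congr fun n => ?_
  simp [wseq, Fseq, F, Lser]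

theorem hasSum_Lser_pow (hq1 : ‖q‖ < 1) (n : ℕ) :
    (Summable fun m => ‖PowerSeries.coeff m (Lser q ^ n)‖) ∧
      ∑' m, PowerSeries.coeff m (Lser q ^ n) = (∑' m, PowerSeries.coeff m (Lser q)) ^ n := by
  induction n with
  | zero =>
    constructor
    · refine summable_of_ne_finset_zero (s := {0}) fun m hm => ?_
      have : m ≠ 0 := by simpa using hm
      simp [PowerSeries.coeff_one, this]
    · rw [tsum_eq_single 0 fun m hm => by simp [PowerSeries.coeff_one, hm]]
      simp
  | succ n ih =>
    have hL := summable_Lser hq1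
    have h (m : ℕ) := PowerSeries.coeff_mul m (Lser q ^ n) (Lser q)
    rw [pow_succ, pow_succ]
    constructor
    · exact (summable_norm_sum_mul_antidiagonal_of_summable_norm ih.1 hL).congr
        fun m => congrArg norm (h m).symm
    · rw [← ih.2, tsum_mul_tsum_eq_tsum_sum_antidiagonal_of_summable_norm ih.1 hL]
      exact tsum_congr h

/-- The limit is the value of L(t)^n/n! at t = 1, by absolute convergence. -/
theorem dseq_tendsTo (hq1 : ‖q‖ < 1) (n : ℕ) : (dseq q n).TendsTo
    ((n.factorial : ℂ)⁻¹ * (∑' m, PowerSeries.coeff m (Lser q)) ^ n) := by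
  obtain ⟨hs, ht⟩ := hasSum_Lser_pow hq1 n
  have h := (hs.of_norm.hasSum.mul_left ((n.factorial : ℂ)⁻¹)).tendsto_sum_nat
  rw [ht, ← tendsto_add_atTop_iff_nat 1] at h
  rw [dseq_eq_cum hq1]
  refine h.congr fun N => ?_
  simp only [cum_apply, vser, PowerSeries.coeff_C_mul]

/-! ### The limit of `1 / (1 - g_1 X)` -/

/-- Truncated sums of `g_{i+1}`. -/
def sseq (q : ℂ) (i : ℕ) : Seq q := step (.g i.succPNat) 1

theorem step_succ_apply (u : Letter) (f : Seq q) (N : ℕ) :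
    step u f (N + 1) = step u f N + F q (N + 1) u * f N := by
  rw [step_apply, psum_succ]; rfl

theorem F_g_eq_pow (m i : ℕ) :
    F q m (.g i.succPNat) = F q m (.g 1) ^ (i + 1) := by
  simp only [F, Nat.succPNat_coe, Nat.succ_eq_add_one, PNat.one_coe, div_pow, ← pow_mul, one_mul, mul_comm m]

/-- Newton's identities: this is the logarithmic derivative of ∏(1+F_q(m;g_1)X), whose power sums
are the truncated sums of g_{i+1} because F_q(m;g_{i+1}) = F_q(m;g_1)^(i+1). -/
theorem derivative_pseq (N : ℕ) :
    PowerSeries.derivative ℂ (PowerSeries.mk fun n => pseq q n N) =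
      (PowerSeries.mk fun n => pseq q n N) * PowerSeries.mk fun i => (-1) ^ i * sseq q i N := by
  induction N with
  | zero =>
    have h : (PowerSeries.mk fun n => pseq q n 0) = 1 := by
      ext n
      cases n with
      | zero => simp [pseq, Seq.one_apply]
      | succ n =>
        simp only [PowerSeries.coeff_mk, PowerSeries.coeff_one, Nat.succ_ne_zero, if_false]
        rfl
    have h' : (PowerSeries.mk fun i => (-1) ^ i * sseq q i 0) = 0 := by
      ext i
      rw [PowerSeries.coeff_mk, sseq, step_apply, psum_zero]
      simp
    rw [h, h', PowerSeries.derivative_one, mul_zero]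
  | succ N ih =>
    set x := F q (N + 1) (.g 1) with hx
    have h1 : (PowerSeries.mk fun n => pseq q n (N + 1)) =
        (PowerSeries.mk fun n => pseq q n N) * (1 + PowerSeries.C x * PowerSeries.X) := by
      ext n
      rw [mul_add, mul_one, mul_left_comm, map_add, PowerSeries.coeff_C_mul]
      cases n with
      | zero => simp [pseq, Seq.one_apply]
      | succ n =>
        rw [PowerSeries.coeff_succ_mul_X]
        simp only [PowerSeries.coeff_mk, pseq]
        rw [step_succ_apply]
    have h2 : (PowerSeries.mk fun i => (-1) ^ i * sseq q i (N + 1)) =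
        (PowerSeries.mk fun i => (-1) ^ i * sseq q i N) +
          PowerSeries.mk fun i => (-1) ^ i * x ^ (i + 1) := by
      ext i
      rw [map_add, PowerSeries.coeff_mk, PowerSeries.coeff_mk, PowerSeries.coeff_mk, sseq,
        step_succ_apply, F_g_eq_pow, Seq.one_apply]
      ring
    have h3 : (1 + PowerSeries.C x * PowerSeries.X) *
        (PowerSeries.mk fun i => (-1) ^ i * x ^ (i + 1)) = PowerSeries.C x := by
      ext i
      rw [add_mul, one_mul, mul_assoc, map_add, PowerSeries.coeff_C_mul]
      cases i with
      | zero => simp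
      | succ i =>
        rw [PowerSeries.coeff_succ_X_mul, PowerSeries.coeff_mk, PowerSeries.coeff_mk,
          PowerSeries.coeff_C, if_neg (Nat.succ_ne_zero i)]
        ring
    have h4 : PowerSeries.derivative ℂ (1 + PowerSeries.C x * PowerSeries.X) = PowerSeries.C x := by
      ext i
      rw [PowerSeries.coeff_derivative, map_add, PowerSeries.coeff_C_mul, PowerSeries.coeff_X,
        PowerSeries.coeff_one, PowerSeries.coeff_C]
      cases i <;> simp
    rw [h1, h2, Derivation.leibniz, h4, ih, smul_eq_mul, smul_eq_mul]
    linear_combination (-(PowerSeries.mk fun n => pseq q n N)) * h3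

theorem succ_mul_pseq (n N : ℕ) : ((n : ℂ) + 1) * pseq q (n + 1) N =
    ∑ p ∈ antidiagonal n, pseq q p.1 N * ((-1) ^ p.2 * sseq q p.2 N) := by
  have h := congrArg (PowerSeries.coeff n) (derivative_pseq (q := q) N)
  rw [PowerSeries.coeff_derivative, PowerSeries.coeff_mul, PowerSeries.coeff_mk] at h
  simp only [PowerSeries.coeff_mk] at h
  rw [← h, mul_comm]

theorem zl_li (u : Letter) : zl q (li u) = step u 1 := by
  rw [← one_mul (li u), zl_mul, zl_one, app_li]

theorem sseq_tendsTo (hq1 : ‖q‖ < 1) (i : ℕ) : (sseq q i).TendsTo (Z q (g (i + 1))) := by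
  have h := tendsTo_Z hq1 (li_g_mem_LH i.succPNat)
  rwa [zl_li, toH_li_g] at h

theorem tsum_Lser (hq1 : ‖q‖ < 1) : ∑' m, PowerSeries.coeff m (Lser q) = Z q (g 1) := by
  have h := dseq_tendsTo hq1 1
  have h' := sseq_tendsTo hq1 0
  have e : dseq q 1 = sseq q 0 := by
    rw [dseq_succ]
    simp [cinv_zero, dseq_zero, sseq]
    rfl
  rw [e] at h
  simpa using h.unique h'

/-- The claimed limit satisfies the limiting form of Newton's recursion with the same constant term
1, so the coefficients converge by induction. -/
theorem pseq_tendsTo (hq1 : ‖q‖ < 1) (n : ℕ) : (pseq q n).TendsTo (PowerSeries.coeff n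
    ((PowerSeries.exp ℂ).subst (logSeries q) *
      PowerSeries.mk fun n => (n.factorial : ℂ)⁻¹ * Z q (g 1) ^ n)) := by
  set c := Z q (g 1)
  set E := (PowerSeries.exp ℂ).subst (logSeries q)
  set D : PowerSeries ℂ := PowerSeries.mk fun n => (n.factorial : ℂ)⁻¹ * c ^ n with hD
  have h0 : PowerSeries.constantCoeff (logSeries q) = 0 := by
    rw [← PowerSeries.coeff_zero_eq_constantCoeff, logSeries, PowerSeries.coeff_mk]
    simp
  have hs : PowerSeries.HasSubst (logSeries q) := PowerSeries.HasSubst.of_constantCoeff_zero' h0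
  have hE : PowerSeries.derivative ℂ E = E * PowerSeries.derivative ℂ (logSeries q) := by
    rw [PowerSeries.derivative_subst hs, PowerSeries.derivative_exp]
  have hE0 : PowerSeries.constantCoeff E = 1 := by
    change MvPowerSeries.constantCoeff E = 1
    rw [PowerSeries.constantCoeff_subst hs, finsum_eq_single _ 0]
    · simp
    · intro n hn
      rw [map_pow, show MvPowerSeries.constantCoeff (logSeries q) = 0 from h0, zero_pow hn,
        smul_zero]
  have hD' : PowerSeries.derivative ℂ D = D * PowerSeries.C c := by
    ext n
    rw [PowerSeries.coeff_derivative, PowerSeries.coeff_mul_C, hD, PowerSeries.coeff_mk,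
      PowerSeries.coeff_mk, Nat.factorial_succ, pow_succ]
    have h1 := Nat.cast_ne_zero (R := ℂ).mpr (Nat.factorial_ne_zero n)
    have h2 := Nat.cast_add_one_ne_zero (R := ℂ) n
    push_cast
    field_simp
  -- The linear term missing from `logSeries` is supplied by the factor `D`.
  have hG : ∀ i, PowerSeries.coeff i (PowerSeries.derivative ℂ (logSeries q) + PowerSeries.C c) =
      (-1) ^ i * Z q (g (i + 1)) := by
    intro i
    rw [map_add, PowerSeries.coeff_derivative, logSeries, PowerSeries.coeff_mk, PowerSeries.coeff_C]
    cases i with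
    | zero => simp [c]
    | succ i =>
      have h2 := Nat.cast_add_one_ne_zero (R := ℂ) (i + 1)
      rw [if_pos (by omega), if_neg (by omega), add_zero, Nat.add_sub_cancel]
      push_cast at h2 ⊢
      field_simp
  have hED : PowerSeries.derivative ℂ (E * D) =
      (E * D) * (PowerSeries.derivative ℂ (logSeries q) + PowerSeries.C c) := by
    rw [Derivation.leibniz, hE, hD', smul_eq_mul, smul_eq_mul]
    ring
  induction n using Nat.strong_induction_on with
  | _ n ih =>
    cases n with
    | zero =>
      have : PowerSeries.coeff 0 (E * D) = 1 := by
        rw [PowerSeries.coeff_zero_eq_constantCoeff, map_mul, hE0,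
          ← PowerSeries.coeff_zero_eq_constantCoeff, hD, PowerSeries.coeff_mk]
        simp
      rw [this]
      exact Seq.tendsTo_one
    | succ n =>
      have h2 := Nat.cast_add_one_ne_zero (R := ℂ) n
      have h := congrArg (PowerSeries.coeff n) hED
      rw [PowerSeries.coeff_derivative, PowerSeries.coeff_mul n] at h
      simp only [hG] at h
      rw [eq_div_of_mul_eq h2 h]
      have key : Tendsto (fun N => ∑ p ∈ antidiagonal n,
          pseq q p.1 N * ((-1) ^ p.2 * sseq q p.2 N)) atTop (𝓝 (∑ p ∈ antidiagonal n,
            PowerSeries.coeff p.1 (E * D) * ((-1) ^ p.2 * Z q (g (p.2 + 1))))) := by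
        refine tendsto_finsetSum _ fun p hp => ?_
        have hp' := Finset.HasAntidiagonal.mem_antidiagonal.mp hp
        exact Tendsto.mul (ih p.1 (by omega)) (Tendsto.const_mul _ (sseq_tendsTo hq1 p.2))
      refine (key.div_const ((n : ℂ) + 1)).congr fun N => ?_
      rw [← succ_mul_pseq, mul_div_cancel_left₀ _ h2]

/-! ### The main theorem -/

theorem exists_tendsTo_of_mem_ZHat (hq1 : ‖q‖ < 1) {z : ℂ} (hz : z ∈ ZHat q) :
    ∃ x ∈ SH q, x.TendsTo z := by
  obtain ⟨w, hw, rfl⟩ := hz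
  rw [SetLike.mem_coe, HHat_eq] at hw
  obtain ⟨x, hx, rfl⟩ := hw
  exact ⟨zl q x, by rw [← map_LH]; exact ⟨x, hx, rfl⟩, tendsTo_Z hq1 hx⟩

/-- `Ẑ_q` as a subring of `ℂ`. -/
def ZRing (hq1 : ‖q‖ < 1) : Subring ℂ where
  carrier := ZHat q
  mul_mem' hy hz := by
    obtain ⟨x, hx, hx'⟩ := exists_tendsTo_of_mem_ZHat hq1 hy
    obtain ⟨y, hy, hy'⟩ := exists_tendsTo_of_mem_ZHat hq1 hz
    exact mem_ZHat_of_tendsTo (mul_mem_SH hx hy) (hx'.mul hy')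
  one_mem' := mem_ZHat_of_tendsTo one_mem_SH Seq.tendsTo_one
  add_mem' hy hz := by
    obtain ⟨x, hx, hx'⟩ := exists_tendsTo_of_mem_ZHat hq1 hy
    obtain ⟨y, hy, hy'⟩ := exists_tendsTo_of_mem_ZHat hq1 hz
    exact mem_ZHat_of_tendsTo (add_mem hx hy) (hx'.add hy')
  zero_mem' := mem_ZHat_of_tendsTo (zero_mem _) Seq.tendsTo_zero
  neg_mem' hy := by
    obtain ⟨x, hx, hx'⟩ := exists_tendsTo_of_mem_ZHat hq1 hy
    exact mem_ZHat_of_tendsTo (neg_mem hx) (Tendsto.neg hx')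

/-- `exp (Z_q(g_1) X)`. -/
def dser (q : ℂ) : PowerSeries ℂ := PowerSeries.mk fun n => (n.factorial : ℂ)⁻¹ * Z q (g 1) ^ n

theorem dseq_tendsTo_dser (hq1 : ‖q‖ < 1) (n : ℕ) :
    (dseq q n).TendsTo (PowerSeries.coeff n (dser q)) := by
  have h := dseq_tendsTo hq1 n
  rw [tsum_Lser hq1] at h
  rwa [dser, PowerSeries.coeff_mk]

/-- The series is the quotient of the limits of `pseq` and `dseq`; the divisor has constant term 1,
so the division stays in the ring Ẑ_q. -/
theorem coeff_exp_logSeries_mem (hq1 : ‖q‖ < 1) (n : ℕ) :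
    PowerSeries.coeff n ((PowerSeries.exp ℂ).subst (logSeries q)) ∈ ZHat q :=
  coeff_mem_of_mul_eq (ZRing hq1) (u := dser q) rfl
    (by rw [← PowerSeries.coeff_zero_eq_constantCoeff, dser, PowerSeries.coeff_mk]; simp)
    (fun n => mem_ZHat_of_tendsTo (dseq_mem_SH n) (dseq_tendsTo_dser hq1 n))
    (fun n => mem_ZHat_of_tendsTo (pseq_mem_SH n) (pseq_tendsTo hq1 n)) n

theorem exists_EIndex (k : Index) (hk : Admissible k) :
    ∃ x : LA, toH x = EIndex k ∧ x - gA k ∈ LN := by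
  by_cases h : k = []
  · subst h
    exact ⟨1, by rw [map_one, EIndex, EAux, E1_zero], by
      rw [gA, List.map_nil, List.prod_nil, sub_self]; exact zero_mem _⟩
  · obtain ⟨x, hx, hx'⟩ := exists_EAux 0 k h (hk h)
    exact ⟨x, hx, by rwa [pow_zero, one_mul] at hx'⟩

theorem coeff_gIndex_mul_geom (k : Index) (n : ℕ) :
    PowerSeries.coeff n (PowerSeries.C (gIndex k) * geom (g 1)) =
      toH (gA k * li (.g 1) ^ n) := by
  rw [PowerSeries.coeff_C_mul, geom, PowerSeries.coeff_mk, map_mul, toH_gA, map_pow, toH_li_g]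
  rfl

theorem li_g_pow_mem_LH (n : ℕ) : li (.g 1) ^ n ∈ LH := by
  induction n with
  | zero => rw [pow_zero]; exact one_mem_LH
  | succ n ih => rw [pow_succ]; exact mul_mem_LH ih (li_g_mem_LH 1)

theorem zl_gA_mul_pow (k : Index) (n : ℕ) :
    zl q (gA k * li (.g 1) ^ n) = (step (.g 1) ^ n) (zl q (gA k)) := by
  rw [zl_mul, app_pow, app_li]

theorem step_pow_one (n : ℕ) : (step (.g 1) ^ n) 1 = pseq q n := by
  induction n with
  | zero => rfl
  | succ n ih => rw [pow_succ', Module.End.mul_apply, ih, pseq]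

/-- Admissibility says that the last letter has exponent at least 2, as `J2` requires. -/
theorem exists_zl_gA_eq_psum (k : Index) (hk : Admissible k) (hne : k ≠ []) :
    ∃ x ∈ J2 q, zl q (gA k) = psum x := by
  refine ⟨Fseq q (.g (k.getLast hne)) * zl q (gA k.dropLast),
    Fseq_mul_mem_J2 (hk hne) (zl_mem_SA _), ?_⟩
  have h : gA k = gA k.dropLast * li (.g (k.getLast hne)) := by
    conv_lhs => rw [← List.dropLast_append_getLast hne]
    simp [gA]
  rw [h, zl_mul, app_li, step_apply]

theorem coeff_sub_mem_NN (hq1 : ‖q‖ < 1) {k : Index} (hk : Admissible k) (hne : k ≠ [])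
    {x : LA} (hxk : x - gA k ∈ LN) {Y T : PowerSeries ℂ}
    (hY : ∀ n, (zl q (gA k * li (.g 1) ^ n)).TendsTo (PowerSeries.coeff n Y))
    (hT : ∀ n, (zl q (x * dA n)).TendsTo (PowerSeries.coeff n T)) (n : ℕ) :
    PowerSeries.coeff n (Y - (PowerSeries.exp ℂ).subst (logSeries q) * T) ∈ NN q := by
  obtain ⟨y, hy, hgy⟩ := exists_zl_gA_eq_psum (q := q) k hk hne
  have hB (n : ℕ) : ∃ z, (psum (xseq y n)).TendsTo z :=
    SH_le_convergent hq1 (psum_mem_SH (xseq_mem hy n))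
  choose β hβ using hB
  have hE (n : ℕ) : ∃ z ∈ SH q, z.TendsTo (PowerSeries.coeff n
      ((PowerSeries.exp ℂ).subst (logSeries q))) :=
    exists_tendsTo_of_mem_ZHat hq1 (coeff_exp_logSeries_mem hq1 n)
  choose ε hε hε' using hE
  set E : PowerSeries ℂ := (PowerSeries.exp ℂ).subst (logSeries q) with hE
  -- The limit of the exact identity for B·P.
  have hYB : Y = PowerSeries.mk β * (E * dser q) := by
    ext n
    have h := hY n
    rw [zl_gA_mul_pow, hgy, ← sum_psum_xseq_mul_pseq] at h
    refine h.unique ?_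
    rw [PowerSeries.coeff_mul]
    exact Seq.TendsTo.sum fun p => by
      rw [PowerSeries.coeff_mk]; exact (hβ p.1).mul (pseq_tendsTo hq1 p.2)
  have hν (n : ℕ) : ∑ p ∈ antidiagonal n, psum (xseq y p.1) * dseq q p.2 - zl q (x * dA n) ∈
      SN q := by
    have h1 : zl q (x - gA k) ∈ SN q := by rw [← map_LN]; exact ⟨_, hxk, rfl⟩
    convert sub_mem (sum_psum_xseq_mul_dseq_sub_mem hy n) (app_dA_mem_SN h1 n) using 1
    rw [zl_mul, map_sub, map_sub, hgy]
    abel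
  have hν' (n : ℕ) : (∑ p ∈ antidiagonal n, psum (xseq y p.1) * dseq q p.2 -
      zl q (x * dA n)).TendsTo (PowerSeries.coeff n (PowerSeries.mk β * dser q - T)) := by
    rw [map_sub, PowerSeries.coeff_mul]
    refine Seq.TendsTo.sub (Seq.TendsTo.sum fun p => ?_) (hT n)
    rw [PowerSeries.coeff_mk]
    exact (hβ p.1).mul (dseq_tendsTo_dser hq1 p.2)
  -- The congruence for B·D is multiplied by E; the ideal property is applied to the sequences
  -- before passing to the limit.
  rw [hYB, show PowerSeries.mk β * (E * dser q) - E * T =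
    E * (PowerSeries.mk β * dser q - T) by ring, PowerSeries.coeff_mul]
  exact mem_NN_of_tendsTo (sum_mem fun p _ => by
    rw [mul_comm]; exact mul_mem_SN (hν p.2) (hε p.1))
    (Seq.TendsTo.sum (s := antidiagonal n) fun p => (hε' p.1).mul (hν' p.2))

end QMZV
end

theorem mainTheorem4 (q : ℂ) (hq0 : 0 < ‖q‖) (hq1 : ‖q‖ < 1)
    (k : QMZV.Index) (hk : QMZV.Admissible k) :
    (∀ w ∈ QMZV.HHat, Filter.Tendsto (fun M : ℕ => QMZV.ZM q M w) Filter.atTop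
        (nhds (QMZV.Z q w))) ∧
    (∀ n, PowerSeries.coeff n
        (PowerSeries.C (QMZV.gIndex k) * QMZV.geom (QMZV.g 1)) ∈ QMZV.HHat) ∧
    (∀ n, PowerSeries.coeff n
        (PowerSeries.C (QMZV.EIndex k) *
          QMZV.expSh (PowerSeries.C (QMZV.g 1) * PowerSeries.X)) ∈ QMZV.HHat) ∧
    (∀ n, PowerSeries.coeff n
        (QMZV.ZSeries q (PowerSeries.C (QMZV.gIndex k) * QMZV.geom (QMZV.g 1))) ∈
          QMZV.ZHat q) ∧
    (∀ n, PowerSeries.coeff n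
        ((PowerSeries.exp ℂ).subst (QMZV.logSeries q) *
          QMZV.ZSeries q (PowerSeries.C (QMZV.EIndex k) *
            QMZV.expSh (PowerSeries.C (QMZV.g 1) * PowerSeries.X))) ∈ QMZV.ZHat q) ∧
    (∀ n, PowerSeries.coeff n
        (QMZV.ZSeries q (PowerSeries.C (QMZV.gIndex k) * QMZV.geom (QMZV.g 1)) -
          (PowerSeries.exp ℂ).subst (QMZV.logSeries q) *
            QMZV.ZSeries q (PowerSeries.C (QMZV.EIndex k) *
              QMZV.expSh (PowerSeries.C (QMZV.g 1) * PowerSeries.X))) ∈ QMZV.NN q) := by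
  open QMZV in
  obtain ⟨x, hx, hxN⟩ := exists_EIndex k hk
  have hxH : x ∈ LH := by
    have := add_mem (LN_le_LH hxN) (gA_mem_LH k)
    rwa [sub_add_cancel] at this
  have hE (n : ℕ) : PowerSeries.coeff n (PowerSeries.C (EIndex k) *
      expSh (PowerSeries.C (g 1) * PowerSeries.X)) = toH (x * dA n) := by
    rw [PowerSeries.coeff_C_mul, coeff_expSh, map_mul, hx]
  have hgH (n : ℕ) : gA k * li (.g 1) ^ n ∈ LH := mul_mem_LH (gA_mem_LH k) (li_g_pow_mem_LH n)
  have hEH (n : ℕ) : x * dA n ∈ LH := mul_mem_LH hxH (dA_mem_LH n)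
  set Y := ZSeries q (PowerSeries.C (gIndex k) * geom (g 1)) with hY
  set T := ZSeries q (PowerSeries.C (EIndex k) *
    expSh (PowerSeries.C (g 1) * PowerSeries.X)) with hT
  have hY' (n : ℕ) : (zl q (gA k * li (.g 1) ^ n)).TendsTo (PowerSeries.coeff n Y) := by
    rw [hY, ZSeries, PowerSeries.coeff_mk, coeff_gIndex_mul_geom]
    exact tendsTo_Z hq1 (hgH n)
  have hT' (n : ℕ) : (zl q (x * dA n)).TendsTo (PowerSeries.coeff n T) := by
    rw [hT, ZSeries, PowerSeries.coeff_mk, hE]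
    exact tendsTo_Z hq1 (hEH n)
  have hYZ (n : ℕ) : PowerSeries.coeff n Y ∈ ZHat q := by
    rw [hY, ZSeries, PowerSeries.coeff_mk, coeff_gIndex_mul_geom]
    exact ⟨_, toH_mem_HHat (hgH n), rfl⟩
  have hTZ (n : ℕ) : PowerSeries.coeff n T ∈ ZHat q := by
    rw [hT, ZSeries, PowerSeries.coeff_mk, hE]
    exact ⟨_, toH_mem_HHat (hEH n), rfl⟩
  refine ⟨fun w hw => ?_, fun n => ?_, fun n => ?_, hYZ, fun n => ?_, fun n => ?_⟩
  · rw [HHat_eq] at hw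
    obtain ⟨y, hy, rfl⟩ := hw
    exact (tendsto_ZM_iff y _).mpr (tendsTo_Z hq1 hy)
  · rw [coeff_gIndex_mul_geom]
    exact toH_mem_HHat (hgH n)
  · rw [hE]
    exact toH_mem_HHat (hEH n)
  · rw [PowerSeries.coeff_mul]
    exact (ZRing hq1).sum_mem fun p _ =>
      (ZRing hq1).mul_mem (coeff_exp_logSeries_mem hq1 _) (hTZ _)
  -- The empty index has no last letter with exponent at least 2; there both sides are equal.
  · by_cases hne : k = []
    · subst hne
      have hx1 : x = 1 := toH_injective (by rw [hx, EIndex, EAux, E1_zero, map_one])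
      have h1 : Y = (PowerSeries.exp ℂ).subst (logSeries q) * dser q := by
        ext n
        refine (hY' n).unique ?_
        rw [zl_gA_mul_pow, gA, List.map_nil, List.prod_nil, zl_one, step_pow_one]
        exact pseq_tendsTo hq1 n
      have h2 : T = dser q := by
        ext n
        refine (hT' n).unique ?_
        rw [hx1, one_mul]
        exact dseq_tendsTo_dser hq1 n
      rw [h1, h2, sub_self, map_zero]
      exact mem_NN_of_tendsTo (zero_mem _) Seq.tendsTo_zero
    · exact coeff_sub_mem_NN hq1 hk hne hxN hY' hT' n
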